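/- Let $V=\mathbb R^5$ with basis $a,b,c,d,e$. For an alternating bilinear map $\mu\in\Lambda^2V^*\otimes V$ and $k\ge 1$ put $N_k(\mu)(x_1,\dots,x_{k+1})=\mu(\dots\mu(\mu(x_1,x_2),x_3)\dots,x_{k+1})$, and let $\mathcal N_{5,k}$ be the variety of all $\mu\in\Lambda^2V^*\otimes V$ that satisfy the Jacobi identity and $N_k(\mu)=0$, i.e. of the at most $k$-step nilpotent Lie algebra structures on $V$. A point $\mu\in\mathcal N_{5,k}$ is called rigid in $\mathcal N_{5,k}$ if its orbit under $g\cdot\mu=g\,\mu(g^{-1}\,\cdot\,,g^{-1}\,\cdot\,)$, $g\in GL(V)$, is Zariski open in $\mathcal N_{5,k}$. For a $k$-step nilpotent Lie algebra $\mathfrak g=(V,\mu)$ let $$H^2_{k\text{-}nil}(\mathfrak g,\mathfrak g)=\frac{\operatorname{Ker}(d^2_\mu)\cap\operatorname{Ker}(dN_k|_\mu)}{\operatorname{Im}(d^1_\mu)},$$ where $d^1_\mu:V^*\otimes V\to\Lambda^2V^*\otimes V$ and $d^2_\mu:\Lambda^2V^*\otimes V\to\Lambda^3V^*\otimes V$ are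 the Chevalley--Eilenberg differentials of $\mathfrak g$ with adjoint coefficients and $dN_k|_\mu$ is the differential of $N_k$ at $\mu$. Let $\mu$ be the Lie bracket of $\mathfrak g_{5,3}$: $[a,b]=d$, $[a,d]=e$, $[b,c]=e$ (brackets of basis vectors that are not listed and do not follow by antisymmetry are zero, here and below). Then: 1. $\mathfrak g_{5,3}$ is rigid in $\mathcal N_{5,3}$. 2. $\dim H^2_{3\text{-}nil}(\mathfrak g_{5,3},\mathfrak g_{5,3})=2$, and this space is spanned by the classes of the alternating maps $\nu_1$, $\nu_2$ with $\nu_1(b,c)=c$ and $\nu_2(a,b)=b$, $\nu_2(a,c)=-c$, $\nu_2(a,d)=-d$, both of which lie in $\operatorname{Ker}(d^2_\mu)\cap\operatorname{Ker}(dN_3|_\mu)$. For $i=1,2$ and every $t\in\mathbb R$, $\mu+t\nu_i$ is a solvable Lie algebra structure on $V$. 3. Consequently the implication "$\lambda$ rigid in $\mathcal N_{5,3}$ $\Rightarrow$ $H^2_{3\text{-}nil}(\lambda,\lambda)=0$" is false. 4. Each of the following Lie algebras is nilpotent of step exactly $k$, and $\dim H^2_{k\text{-}nil}(\mathfrak g,\mathfrak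 g)$ is as listed, written as $\dim\big(\operatorname{Ker}(d^2_\mu)\cap\operatorname{Ker}(dN_k|_\mu)\big)-\dim\operatorname{Im}(d^1_\mu)$: - $k=2$: $\mathfrak f_3\oplus\mathbb R^2$ ($[a,b]=c$): $11=20-9$; $\mathfrak g_{5,1}$ ($[a,b]=e$, $[c,d]=e$): $0=10-10$; $\mathfrak g_{5,2}$ ($[a,b]=d$, $[a,c]=e$): $0=12-12$; - $k=3$: $\mathfrak f_4\oplus\mathbb R$ ($[a,b]=c$, $[a,c]=d$): $4=18-14$; $\mathfrak g_{5,3}$: $2=17-15$; $\mathfrak g_{5,4}$ ($[a,b]=c$, $[a,c]=d$, $[b,c]=e$): $0=15-15$; - $k=4$: $\mathfrak f_5$ ($[a,b]=c$, $[a,c]=d$, $[a,d]=e$): $1=17-16$; $\mathfrak g_{5,6}$ ($[a,b]=c$, $[a,c]=d$, $[a,d]=e$, $[b,c]=e$): $0=17-17$. 5. Every non-abelian nilpotent real Lie algebra of dimension 5 is isomorphic to exactly one of these eight. -/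

import Mathlib

set_option maxSynthPendingDepth 3

namespace NilLie

open LieModule.Cohomology

section General

variable (V : Type*) [AddCommGroup V] [Module ℝ V]

/-- The space `Λ²V* ⊗ V` of alternating bilinear maps `V × V → V`. -/
def AltBracket : Submodule ℝ (V →ₗ[ℝ] V →ₗ[ℝ] V) where
  carrier := {μ | ∀ x, μ x x = 0}
  add_mem' {a b} ha hb x := by simp [ha x, hb x]
  zero_mem' := by simp
  smul_mem' t {c} hc x := by simp [hc x]

/-- The variety of Lie algebra structures on `V`: alternating brackets with `J(μ) = 0`. -/
def lieVariety : Set (AltBracket V) :=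
  {μ | ∀ x y z, μ.1 (μ.1 x y) z + μ.1 (μ.1 y z) x + μ.1 (μ.1 z x) y = 0}

variable {V}

/-- The iterated product `N_k(β)(x_1, …, x_{k+1}) = β(…β(β(x_1, x_2), x_3)…, x_{k+1})`. -/
def iterN (β : V →ₗ[ℝ] V →ₗ[ℝ] V) : (k : ℕ) → (Fin (k + 1) → V) → V
  | 0, x => x 0
  | k + 1, x => β (iterN β k (Fin.init x)) (x (Fin.last (k + 1)))

/-- The differential of `N_k` at `β`, by the product rule (see `hasDerivAt_iterN`):
`dN_{k+1}(σ)(x) = σ(N_k(x_1, …, x_{k+1}), x_{k+2}) + β(dN_k(σ)(x_1, …, x_{k+1}), x_{k+2})`. -/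
def dIterN (β : V →ₗ[ℝ] V →ₗ[ℝ] V) :
    (k : ℕ) → (V →ₗ[ℝ] V →ₗ[ℝ] V) →ₗ[ℝ] ((Fin (k + 1) → V) → V)
  | 0 => 0
  | k + 1 =>
    { toFun := fun σ x => σ (iterN β k (Fin.init x)) (x (Fin.last (k + 1))) +
        β (dIterN β k σ (Fin.init x)) (x (Fin.last (k + 1)))
      map_add' := fun σ τ => by ext x; simp; abel
      map_smul' := fun c σ => by ext x; simp }

variable (V) in
/-- The variety of (at most) `k`-step nilpotent Lie algebra structures on `V`: Lie brackets with
`N_k(μ) = 0`, that is, with vanishing `k`-th term of the descending central series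
(see `mem_nilVariety_iff`). -/
def nilVariety (k : ℕ) : Set (AltBracket V) :=
  {μ | μ ∈ lieVariety V ∧ ∀ x, iterN μ.1 k x = 0}

/-- The action `(g · μ)(x, y) = g(μ(g⁻¹x, g⁻¹y))` of `GL(V)` on brackets. -/
def act (g : V ≃ₗ[ℝ] V) (μ : AltBracket V) : AltBracket V :=
  ⟨(μ.1.compl₁₂ (g.symm : V →ₗ[ℝ] V) (g.symm : V →ₗ[ℝ] V)).compr₂ (g : V →ₗ[ℝ] V),
    fun x => by simp [μ.2 (g.symm x)]⟩

/-- The `GL(V)`-orbit of a bracket. -/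
def orbit (μ : AltBracket V) : Set (AltBracket V) := Set.range fun g : V ≃ₗ[ℝ] V => act g μ

/-- `S` is a Zariski open subset of the subset `X` of the vector space `W`: a point of `X` lies
in `S` iff some polynomial function of a given family does not vanish there. Polynomial functions
on `W` are the polynomial expressions in linear forms on `W`. -/
def IsZariskiOpenIn {W : Type*} [AddCommGroup W] [Module ℝ W] (X S : Set W) : Prop :=
  ∃ P : Set (MvPolynomial (Module.Dual ℝ W) ℝ),
    S = {w | w ∈ X ∧ ∃ p ∈ P, MvPolynomial.eval (fun φ : Module.Dual ℝ W => φ w) p ≠ 0}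

/-- `μ` is rigid in the variety `X`: it is a point of `X` whose orbit is Zariski open in `X`. -/
def IsRigidIn (X : Set (AltBracket V)) (μ : AltBracket V) : Prop :=
  μ ∈ X ∧ IsZariskiOpenIn X (orbit μ)

/-- The vector space `V` as a Lie algebra with bracket `μ`. -/
def Alg (_μ : lieVariety V) : Type _ := V

instance (μ : lieVariety V) : AddCommGroup (Alg μ) := inferInstanceAs (AddCommGroup V)

instance (μ : lieVariety V) : LieRing (Alg μ) where
  bracket x y := μ.1.1 x y
  add_lie x y z := LinearMap.map_add₂ μ.1.1 x y z
  lie_add x y z := (μ.1.1 x).map_add y z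
  lie_self x := μ.1.2 x
  leibniz_lie := by
    intro (x : V) (y : V) (z : V)
    have skew : ∀ u v : V, μ.1.1 u v = -μ.1.1 v u := fun u v => by
      have h := μ.1.2 (u + v)
      simp only [map_add, LinearMap.add_apply, μ.1.2 u, μ.1.2 v, zero_add, add_zero] at h
      exact eq_neg_of_add_eq_zero_right h
    have h : μ.1.1 (μ.1.1 x y) z + μ.1.1 (μ.1.1 y z) x + μ.1.1 (μ.1.1 z x) y = 0 := μ.2 x y z
    have h1 : μ.1.1 x (μ.1.1 y z) = -μ.1.1 (μ.1.1 y z) x := skew _ _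
    have h2 : μ.1.1 y (μ.1.1 x z) = μ.1.1 (μ.1.1 z x) y := (skew _ _).trans (by
      rw [show μ.1.1 x z = -μ.1.1 z x from skew x z]
      exact (congrArg Neg.neg (LinearMap.map_neg₂ μ.1.1 _ _)).trans (neg_neg _))
    change μ.1.1 x (μ.1.1 y z) = μ.1.1 (μ.1.1 x y) z + μ.1.1 y (μ.1.1 x z)
    rw [h1, h2, neg_eq_iff_add_eq_zero, ← h]
    abel

instance (μ : lieVariety V) : Module ℝ (Alg μ) := inferInstanceAs (Module ℝ V)

instance (μ : lieVariety V) : LieAlgebra ℝ (Alg μ) where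
  lie_smul t x y := (μ.1.1 x).map_smul t y

theorem lie_def (μ : lieVariety V) (x y : V) :
    (⁅(show Alg μ from x), (show Alg μ from y)⁆ : Alg μ) = μ.1.1 x y := rfl

/-- An element of `Λ²V* ⊗ V` as a 2-cochain of the Lie algebra `(V, μ)` with coefficients in the
adjoint module. -/
def toCochain (μ : lieVariety V) (σ : AltBracket V) : twoCochain ℝ (Alg μ) (Alg μ) :=
  ⟨(show Alg μ →ₗ[ℝ] Alg μ →ₗ[ℝ] Alg μ from σ.1), σ.2⟩

theorem lowerCentralSeries_eq_span (μ : lieVariety V) (k : ℕ) :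
    (LieModule.lowerCentralSeries ℝ (Alg μ) (Alg μ) k).toSubmodule =
      Submodule.span ℝ (Set.range (iterN (V := Alg μ) μ.1.1 k)) := by
  induction k with
  | zero =>
    refine le_antisymm (fun x _ => Submodule.subset_span (Set.mem_range.2 ⟨fun _ => x, rfl⟩)) ?_
    exact fun _ _ => Submodule.mem_top
  | succ k ih =>
    rw [LieModule.lowerCentralSeries_succ, LieSubmodule.lieIdeal_oper_eq_linear_span']
    refine le_antisymm (Submodule.span_le.2 ?_) (Submodule.span_le.2 ?_)
    · rintro _ ⟨x, -, n, hn, rfl⟩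
      rw [← LieSubmodule.mem_toSubmodule, ih] at hn
      induction hn using Submodule.span_induction with
      | mem y hy =>
        obtain ⟨u, rfl⟩ := hy
        rw [← lie_skew]
        refine Submodule.neg_mem _ (Submodule.subset_span
          ⟨Fin.snoc (α := fun _ => Alg μ) u x, ?_⟩)
        simp only [iterN, Fin.init_snoc, Fin.snoc_last]
        rfl
      | zero => simp
      | add a b _ _ ha hb => rw [lie_add]; exact Submodule.add_mem _ ha hb
      | smul c a _ ha => rw [lie_smul]; exact Submodule.smul_mem _ c ha
    · rintro _ ⟨u, rfl⟩
      have h : iterN (V := Alg μ) μ.1.1 (k + 1) u =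
          -⁅u (Fin.last (k + 1)), iterN (V := Alg μ) μ.1.1 k (Fin.init u)⁆ := by
        rw [lie_skew]; rfl
      rw [h]
      refine Submodule.neg_mem _ (Submodule.subset_span ⟨_, trivial, _, ?_, rfl⟩)
      rw [← LieSubmodule.mem_toSubmodule, ih]
      exact Submodule.subset_span ⟨_, rfl⟩

theorem mem_nilVariety_iff (μ : lieVariety V) (k : ℕ) :
    μ.1 ∈ nilVariety V k ↔ LieModule.lowerCentralSeries ℝ (Alg μ) (Alg μ) k = ⊥ := by
  rw [← LieSubmodule.toSubmodule_eq_bot, lowerCentralSeries_eq_span, Submodule.span_eq_bot]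
  exact ⟨fun h x ⟨u, hu⟩ => hu ▸ h.2 u, fun h => ⟨μ.2, fun u => h _ ⟨u, rfl⟩⟩⟩

end General

theorem hasDerivAt_iterN {V : Type*} [NormedAddCommGroup V] [NormedSpace ℝ V]
    [FiniteDimensional ℝ V] (β σ : V →ₗ[ℝ] V →ₗ[ℝ] V) (k : ℕ) (x : Fin (k + 1) → V) :
    HasDerivAt (fun t : ℝ => iterN (β + t • σ) k x) (dIterN β k σ x) 0 := by
  induction k with
  | zero => exact hasDerivAt_const (0 : ℝ) (x 0)
  | succ k ih =>
    have h := ih (Fin.init x)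
    have hl : ∀ γ : V →ₗ[ℝ] V →ₗ[ℝ] V,
        HasDerivAt (fun t : ℝ => γ (iterN (β + t • σ) k (Fin.init x)) (x (Fin.last (k + 1))))
          (γ (dIterN β k σ (Fin.init x)) (x (Fin.last (k + 1)))) 0 := fun γ =>
      ((LinearMap.toContinuousLinearMap (γ.flip (x (Fin.last (k + 1))))).hasFDerivAt).comp_hasDerivAt
        (0 : ℝ) h
    have h2 := (hl β).add ((hasDerivAt_id (0 : ℝ)).smul (hl σ))
    refine HasDerivAt.congr_deriv (h2.congr_of_eventuallyEq (Filter.Eventually.of_forall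
      fun t => ?_)) ?_
    · simp [iterN]
    · simp [dIterN, add_comm]

section Cohomology

variable (L : Type*) [LieRing L] [LieAlgebra ℝ L] (k : ℕ)

/-- The restriction of `dN_k|_μ` to alternating maps, `μ` being the bracket of `L`. -/
def dN : twoCochain ℝ L L →ₗ[ℝ] ((Fin (k + 1) → L) → L) :=
  (dIterN (LieAlgebra.ad ℝ L : L →ₗ[ℝ] Module.End ℝ L) k).comp (twoCochain ℝ L L).subtype

/-- `Ker(d²_μ) ∩ Ker(dN_k|_μ)`. -/
def nilCocycle : Submodule ℝ (twoCochain ℝ L L) :=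
  twoCocycle ℝ L L ⊓ LinearMap.ker (dN L k)

/-- `Im(d¹_μ)`. -/
def coboundary : Submodule ℝ (twoCochain ℝ L L) := LinearMap.range (d₁₂ ℝ L L)

/-- `H²_{k-nil}(L, L) = (Ker(d²_μ) ∩ Ker(dN_k|_μ)) / Im(d¹_μ)`. -/
abbrev H2nil : Type _ := nilCocycle L k ⧸ (coboundary L).submoduleOf (nilCocycle L k)

/-- The class in `H²_{k-nil}(L, L)` of a cocycle. -/
def H2nil.mk (σ : nilCocycle L k) : H2nil L k :=
  Submodule.Quotient.mk σ

end Cohomology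

section Tables

/-- The 5-dimensional space with basis `a, b, c, d, e`, indexed by `0, 1, 2, 3, 4`. -/
abbrev V5 : Type := Fin 5 → ℝ

/-- The alternating bilinear map with `(e_i, e_j) ↦ e_l`, `(e_j, e_i) ↦ -e_l` and vanishing on all
other pairs of basis vectors (for `i ≠ j`). -/
def E (i j l : Fin 5) : AltBracket V5 :=
  ⟨LinearMap.mk₂ ℝ (fun x y => (x i * y j - x j * y i) • Pi.single l 1)
    (fun x y z => by simp only [Pi.add_apply]; module)
    (fun t x y => by simp only [Pi.smul_apply, smul_eq_mul]; module)
    (fun x y z => by simp only [Pi.add_apply]; module)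
    (fun t x y => by simp only [Pi.smul_apply, smul_eq_mul]; module),
    fun x => by simp [mul_comm]⟩

theorem E_apply (i j l : Fin 5) (x y : V5) :
    (E i j l).1 x y = (x i * y j - x j * y i) • Pi.single l 1 := rfl

/-- `𝔣₃ ⊕ ℝ²`: `ab = c`. -/
def f3R2 : lieVariety V5 := ⟨E 0 1 2, fun x y z => by
  ext m; fin_cases m <;> simp [E_apply]⟩

/-- `𝔤₅,₁`: `ab = e`, `cd = e`. -/
def g51 : lieVariety V5 := ⟨E 0 1 4 + E 2 3 4, fun x y z => by
  ext m; fin_cases m <;> simp [E_apply]⟩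

/-- `𝔤₅,₂`: `ab = d`, `ac = e`. -/
def g52 : lieVariety V5 := ⟨E 0 1 3 + E 0 2 4, fun x y z => by
  ext m; fin_cases m <;> simp [E_apply]⟩

/-- `𝔣₄ ⊕ ℝ`: `ab = c`, `ac = d`. -/
def f4R : lieVariety V5 := ⟨E 0 1 2 + E 0 2 3, fun x y z => by
  ext m; fin_cases m <;> simp [E_apply] <;> ring⟩

/-- `𝔤₅,₃`: `ab = d`, `ad = e`, `bc = e`. -/
def g53 : lieVariety V5 := ⟨E 0 1 3 + E 0 3 4 + E 1 2 4, fun x y z => by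
  ext m; fin_cases m <;> simp [E_apply] <;> ring⟩

/-- `𝔤₅,₄`: `ab = c`, `ac = d`, `bc = e`. -/
def g54 : lieVariety V5 := ⟨E 0 1 2 + E 0 2 3 + E 1 2 4, fun x y z => by
  ext m; fin_cases m <;> simp [E_apply] <;> ring⟩

/-- `𝔣₅`: `ab = c`, `ac = d`, `ad = e`. -/
def f5 : lieVariety V5 := ⟨E 0 1 2 + E 0 2 3 + E 0 3 4, fun x y z => by
  ext m; fin_cases m <;> simp [E_apply] <;> ring⟩

/-- `𝔤₅,₆`: `ab = c`, `ac = d`, `ad = e`, `bc = e`. -/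
def g56 : lieVariety V5 := ⟨E 0 1 2 + E 0 2 3 + E 0 3 4 + E 1 2 4, fun x y z => by
  ext m; fin_cases m <;> simp [E_apply] <;> ring⟩

/-- The eight algebras above. -/
def table : Fin 8 → lieVariety V5 := ![f3R2, g51, g52, f4R, g53, g54, f5, g56]

/-- `ν₁(b, c) = c`. -/
def nu1 : AltBracket V5 := E 1 2 2

/-- `ν₂(a, b) = b`, `ν₂(a, c) = -c`, `ν₂(a, d) = -d`. -/
def nu2 : AltBracket V5 := E 0 1 1 - E 0 2 2 - E 0 3 3

/-- The Lie algebra `(V5, μ)` is nilpotent of step exactly `k`, and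
`dim H²_{k-nil} = h = z - b` with `z = dim (Ker d²_μ ∩ Ker dN_k|_μ)` and `b = dim Im d¹_μ`. -/
def TableRow (μ : lieVariety V5) (k h z b : ℕ) : Prop :=
  μ.1 ∈ nilVariety V5 k ∧ (∀ j < k, μ.1 ∉ nilVariety V5 j) ∧
    Module.finrank ℝ (nilCocycle (Alg μ) k) = z ∧
    Module.finrank ℝ (coboundary (Alg μ)) = b ∧
    Module.finrank ℝ (H2nil (Alg μ) k) = h

/-- `μ + tν` is a solvable Lie algebra structure for every real `t`. -/
def IsSolvableLinearDeformation (μ : lieVariety V5) (ν : AltBracket V5) : Prop :=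
  ∀ t : ℝ, ∃ h : μ.1 + t • ν ∈ lieVariety V5,
    LieAlgebra.IsSolvable (Alg (⟨μ.1 + t • ν, h⟩ : lieVariety V5))

end Tables

end NilLie

/-! The proof combines exact integer linear algebra, a classification by central extensions, and two
isomorphism invariants.

Dimensions. The eight brackets have structure constants 0 and ±1. So the cocycle condition together
with `dN_k = 0`, and likewise the derivation condition, are homogeneous linear systems with integer
coefficients: the first in the 50 coordinates of `Λ²V* ⊗ V`, the second in the 25 coordinates of
`End V`. Their ranks come from a fraction-free elimination that the kernel evaluates and that
`finrank_solutions` proves correct over `ℝ`. The rank of `d¹` is the rank of the derivation system.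
Coboundaries are tangent to the orbit, hence satisfy the linearised equations of the variety
(`coboundary_le_nilCocycle`), so the dimension of the cohomology is the difference of the two
numbers. For `g53` these are 17 and 15, and `nu1`, `nu2` are independent modulo coboundaries, so
their classes form a basis.

Classification. A nonzero nilpotent algebra has a central line, and the quotient by it is nilpotent
of dimension one less. In dimension 2 everything is abelian, in dimension 3 only the Heisenberg
algebra is new, and in dimension 4 only its sum with a line and the filiform algebra. In dimension 5
one lifts generators of the quotient; brackets are then known up to multiples of the central vector,
the Jacobi identity kills some of these multiples, and base changes normalise the rest. The
dimension of the coboundary space separates the eight algebras except `g53` and `g54`. Only the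
first of these two has a form `ξ ∘ ⁅·,·⁆` of rank four.

Rigidity. Among the at most 3-step brackets, those that have some form of rank four and some nonzero
double bracket are, by the classification, exactly the orbit of `g53`. Both conditions say that some
polynomial in the bracket is nonzero, so the orbit is Zariski open although the cohomology does not
vanish. -/

namespace NilLie

/-! ### Integer linear systems -/

section LinearSystems

/-- Add `c` to the coefficient at `n` of a sparse linear form. -/
def formInsert (n : ℕ) (c : ℤ) : List (ℕ × ℤ) → List (ℕ × ℤ)
  | [] => match c with
    | .ofNat 0 => []
    | c => [(n, c)]
  | (m, d) :: r => bif Nat.beq n m then match c + d with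
      | .ofNat 0 => r
      | c => (n, c) :: r
    else (m, d) :: formInsert n c r

/-- The sparse form `a • p + r`, computed by insertion. -/
def formAdd (a : ℤ) (p r : List (ℕ × ℤ)) : List (ℕ × ℤ) :=
  p.foldr (fun t s => formInsert t.1 (a * t.2) s) r

/-- The coefficient at `n`. -/
def formCoeff (n : ℕ) : List (ℕ × ℤ) → ℤ
  | [] => 0
  | (m, d) :: r => bif Nat.beq n m then d + formCoeff n r else formCoeff n r

/-- Remove the unknown `n` from `r` by means of the form `p`, whose coefficient at `n` is `c`. -/
def formElim (n : ℕ) (c : ℤ) (p r : List (ℕ × ℤ)) : List (ℕ × ℤ) :=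
  match formCoeff n r with
  | .ofNat 0 => r
  | d => formAdd (-d) p (r.map fun t => (t.1, c * t.2))

/-- The rank of a system of linear forms in the unknowns `0, …, N - 1`, by fraction-free Gaussian
elimination with at most `f` steps. -/
def formRank (N : ℕ) : ℕ → List (List (ℕ × ℤ)) → Option ℕ
  | 0, [] => some 0
  | 0, _ :: _ => none
  | _ + 1, [] => some 0
  | f + 1, [] :: rows => formRank N f rows
  | f + 1, ((n, c) :: p) :: rows =>
    let c' := formCoeff n ((n, c) :: p)
    if n < N ∧ c' ≠ 0 then
      (formRank N f ((rows.map (formElim n c' ((n, c) :: p))).filter (!·.isEmpty))).map (· + 1)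
    else none

/-- The value of a sparse linear form. -/
def formEval (φ : ℕ → ℝ) (r : List (ℕ × ℤ)) : ℝ := (r.map fun t => (t.2 : ℝ) * φ t.1).sum

/-! ### Correctness of the elimination. -/

@[simp] theorem formEval_nil (φ : ℕ → ℝ) : formEval φ [] = 0 := rfl

@[simp] theorem formEval_cons (φ : ℕ → ℝ) (t : ℕ × ℤ) (r : List (ℕ × ℤ)) :
    formEval φ (t :: r) = t.2 * φ t.1 + formEval φ r := by simp [formEval]

theorem formEval_insert (φ : ℕ → ℝ) (n : ℕ) (c : ℤ) (r : List (ℕ × ℤ)) :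
    formEval φ (formInsert n c r) = c * φ n + formEval φ r := by
  induction r with
  | nil =>
    unfold formInsert
    split
    · simp
    · simp
  | cons t r ih =>
    obtain ⟨m, d⟩ := t
    unfold formInsert
    by_cases h : n = m
    · subst h
      have h1 : Nat.beq n n = true := Nat.beq_refl n
      rw [h1, cond_true]
      split
      · rename_i h2
        have h2 : ((c + d : ℤ) : ℝ) = 0 := by rw [h2]; simp
        push_cast at h2
        simp only [formEval_cons]
        linear_combination -(φ n) * h2
      · simp only [formEval_cons]
        push_cast
        ring
    · have h1 : Nat.beq n m = false := by
        rw [← Bool.not_eq_true]; exact fun h' => h (Nat.eq_of_beq_eq_true h')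
      rw [h1, cond_false, formEval_cons, ih, formEval_cons]
      ring

theorem formEval_add (φ : ℕ → ℝ) (a : ℤ) (p r : List (ℕ × ℤ)) :
    formEval φ (formAdd a p r) = a * formEval φ p + formEval φ r := by
  induction p with
  | nil => simp [formAdd]
  | cons t p ih =>
    rw [show formAdd a (t :: p) r = formInsert t.1 (a * t.2) (formAdd a p r) from rfl,
      formEval_insert, ih, formEval_cons]
    push_cast
    ring

theorem formEval_single (n : ℕ) (r : List (ℕ × ℤ)) :
    formEval (Pi.single n 1) r = formCoeff n r := by
  induction r with
  | nil => simp [formCoeff]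
  | cons t r ih =>
    obtain ⟨m, d⟩ := t
    unfold formCoeff
    by_cases h : n = m
    · subst h
      have h1 : Nat.beq n n = true := Nat.beq_refl n
      rw [h1, cond_true, formEval_cons, ih]
      simp
    · have h1 : Nat.beq n m = false := by
        rw [← Bool.not_eq_true]; exact fun h' => h (Nat.eq_of_beq_eq_true h')
      rw [h1, cond_false, formEval_cons, ih]
      simp [Ne.symm h]

theorem formEval_map_mul (φ : ℕ → ℝ) (c : ℤ) (r : List (ℕ × ℤ)) :
    formEval φ (r.map fun t => (t.1, c * t.2)) = c * formEval φ r := by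
  induction r with
  | nil => simp
  | cons t r ih => simp [ih]; ring

/-- There are two alternatives because a row without the unknown `n` is kept as it is, not
multiplied by the pivot `c`. -/
theorem formEval_elim (φ : ℕ → ℝ) (n : ℕ) (c : ℤ) (p r : List (ℕ × ℤ)) :
    formCoeff n r = 0 ∧ formElim n c p r = r ∨
      formEval φ (formElim n c p r) = c * formEval φ r - formCoeff n r * formEval φ p := by
  unfold formElim
  split
  · rename_i h
    exact Or.inl ⟨h, rfl⟩
  · right
    rw [formEval_add, formEval_map_mul]
    push_cast
    ring

/-- Extension of a finite sequence by zero. -/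
def extendZero {N : ℕ} (x : Fin N → ℝ) (n : ℕ) : ℝ := if h : n < N then x ⟨n, h⟩ else 0

theorem extendZero_single {N : ℕ} (n : Fin N) :
    extendZero (Pi.single n 1 : Fin N → ℝ) = Pi.single (n : ℕ) 1 := by
  ext m
  by_cases h : m < N
  · simp [extendZero, h, Pi.single_apply, Fin.ext_iff]
  · have : m ≠ n := fun h' => h (h' ▸ n.2)
    simp [extendZero, h, this]

/-- A sparse linear form as a linear form on `ℝᴺ`. -/
def formLin (N : ℕ) (r : List (ℕ × ℤ)) : (Fin N → ℝ) →ₗ[ℝ] ℝ where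
  toFun x := formEval (extendZero x) r
  map_add' x y := by
    induction r with
    | nil => simp
    | cons t r ih =>
      rw [formEval_cons, ih, formEval_cons, formEval_cons]
      by_cases h : t.1 < N <;> (simp [extendZero, h]; try ring)
  map_smul' a x := by
    induction r with
    | nil => simp
    | cons t r ih =>
      rw [formEval_cons, ih, formEval_cons]
      by_cases h : t.1 < N <;> (simp [extendZero, h]; try ring)

/-- The space of solutions of a homogeneous linear system. -/
def solutions (N : ℕ) (rows : List (List (ℕ × ℤ))) : Submodule ℝ (Fin N → ℝ) where
  carrier := {x | ∀ r ∈ rows, formLin N r x = 0}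
  add_mem' {x y} hx hy r hr := by rw [map_add, hx r hr, hy r hr, add_zero]
  zero_mem' r _ := map_zero _
  smul_mem' a x hx r hr := by rw [map_smul, hx r hr, smul_zero]

theorem mem_solutions {N : ℕ} {rows : List (List (ℕ × ℤ))} {x : Fin N → ℝ} :
    x ∈ solutions N rows ↔ ∀ r ∈ rows, formEval (extendZero x) r = 0 := Iff.rfl

/-- Rank-nullity for `f` restricted to `S`, which is onto `ℝ` because of `v`. -/
theorem finrank_ker_inf_add_one {W : Type*} [AddCommGroup W] [Module ℝ W] [FiniteDimensional ℝ W]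
    (f : W →ₗ[ℝ] ℝ) (S : Submodule ℝ W) {v : W} (hv : v ∈ S) (hf : f v ≠ 0) :
    Module.finrank ℝ (LinearMap.ker f ⊓ S : Submodule ℝ W) + 1 = Module.finrank ℝ S := by
  have hr : LinearMap.range (f.domRestrict S) = ⊤ := by
    rw [LinearMap.range_eq_top]
    intro a
    refine ⟨(a / f v) • ⟨v, hv⟩, ?_⟩
    simp [hf]
  have h := LinearMap.finrank_range_add_finrank_ker (f.domRestrict S)
  rw [hr, finrank_top, Module.finrank_self] at h
  have hk : (LinearMap.ker (f.domRestrict S)).map S.subtype = LinearMap.ker f ⊓ S := by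
    ext x
    constructor
    · rintro ⟨y, hy, rfl⟩
      exact ⟨hy, y.2⟩
    · rintro ⟨h1, h2⟩
      exact ⟨⟨x, h2⟩, h1, rfl⟩
  rw [← hk, Submodule.finrank_map_subtype_eq]
  omega

/-- After elimination no row involves the unknown `n`, so the `n`-th unit vector solves the reduced
system, while the pivot form does not vanish on it. The pivot thus cuts the reduced solution space
in codimension one. On its kernel the reduced rows are the old rows, possibly multiplied by the
nonzero pivot coefficient, so the intersection is the old solution space. -/
theorem solutions_pivot {N : ℕ} (n : Fin N) (p : List (ℕ × ℤ)) (rows : List (List (ℕ × ℤ)))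
    (hc : formCoeff n p ≠ 0) :
    Module.finrank ℝ (solutions N (p :: rows)) + 1 = Module.finrank ℝ (solutions N
      ((rows.map (formElim n (formCoeff n p) p)).filter (!·.isEmpty))) := by
  have hc' : (formCoeff n p : ℝ) ≠ 0 := by exact_mod_cast hc
  set S := solutions N ((rows.map (formElim n (formCoeff n p) p)).filter (!·.isEmpty)) with hS
  have hmem : ∀ x, x ∈ S ↔
      ∀ r ∈ rows, formEval (extendZero x) (formElim n (formCoeff n p) p r) = 0 := by
    intro x
    rw [hS, mem_solutions]
    constructor
    · intro h r hr
      by_cases he : formElim n (formCoeff n p) p r = []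
      · rw [he, formEval_nil]
      · exact h _ (List.mem_filter.2 ⟨List.mem_map.2 ⟨r, hr, rfl⟩, by simpa using he⟩)
    · intro h s hs
      obtain ⟨r, hr, rfl⟩ := List.mem_map.1 (List.mem_filter.1 hs).1
      exact h r hr
  have hv : (Pi.single n 1 : Fin N → ℝ) ∈ S := by
    rw [hmem]
    intro r _
    rw [extendZero_single]
    rcases formEval_elim (Pi.single (n : ℕ) 1) n (formCoeff n p) p r with ⟨h1, h2⟩ | h
    · rw [h2, formEval_single, h1, Int.cast_zero]
    · rw [h, formEval_single, formEval_single]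
      ring
  have hf : formLin N p (Pi.single n 1) ≠ 0 := by
    change formEval (extendZero _) p ≠ 0
    rwa [extendZero_single, formEval_single]
  rw [← finrank_ker_inf_add_one (formLin N p) S hv hf]
  suffices h : solutions N (p :: rows) = LinearMap.ker (formLin N p) ⊓ S by rw [h]
  ext x
  rw [Submodule.mem_inf, hmem, mem_solutions, List.forall_mem_cons]
  refine and_congr_right fun hp => forall₂_congr fun r _ => ?_
  rcases formEval_elim (extendZero x) n (formCoeff n p) p r with ⟨_, h2⟩ | h
  · rw [h2]
  · rw [h, hp, mul_zero, sub_zero, mul_eq_zero, or_iff_right hc']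

/-- Each pivot accounts for one dimension. A run that exhausts its steps or meets an unusable pivot
returns `none`, so nothing has to be known about termination or about the normal form of rows. -/
theorem finrank_solutions {N : ℕ} (f : ℕ) (rows : List (List (ℕ × ℤ))) (k : ℕ)
    (h : formRank N f rows = some k) : Module.finrank ℝ (solutions N rows) + k = N := by
  have h0 : Module.finrank ℝ (solutions N []) + 0 = N := by
    have : solutions N [] = ⊤ := by
      ext x
      simp [mem_solutions]
    rw [this, finrank_top]
    simp
  induction f generalizing rows k with
  | zero =>
    cases rows with
    | nil => cases h; exact h0
    | cons => cases h
  | succ f ih =>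
    match rows, h with
    | [], h => cases h; exact h0
    | [] :: rows, h =>
      suffices hs : solutions N ([] :: rows) = solutions N rows by rw [hs]; exact ih rows k h
      ext x
      simp [mem_solutions]
    | ((n, c) :: p) :: rows, h =>
      unfold formRank at h
      dsimp only at h
      split_ifs at h with hn
      rw [Option.map_eq_some_iff] at h
      obtain ⟨k', hk', rfl⟩ := h
      have h1 := ih _ _ hk'
      have h2 := solutions_pivot ⟨n, hn.1⟩ ((n, c) :: p) rows hn.2
      dsimp only at h2
      omega

end LinearSystems
end NilLie

namespace NilLie

open LieModule.Cohomology

/-! ### Structure constants -/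

section StructureConstants

/-- `μ(w, e_y)` for a vector of linear forms `w = ∑ c xₙ e_m`, given by the list of the
`(m, n, c)`, where `μ` is the sum of the `E i j l` for `(i, j, l)` in `T`. -/
def rmul (T : List (ℕ × ℕ × ℕ)) (y : ℕ) : List (ℕ × ℕ × ℤ) → List (ℕ × ℕ × ℤ)
  | [] => []
  | (m, n, c) :: w => T.foldr (fun t r =>
      bif Nat.beq m t.1 && Nat.beq y t.2.1 then (t.2.2, n, c) :: r
      else bif Nat.beq m t.2.1 && Nat.beq y t.1 then (t.2.2, n, -c) :: r else r) (rmul T y w)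

/-- The basis vectors of `V5`, indexed by natural numbers and extended by zero. -/
def stdVec (m : ℕ) : V5 := fun i => if (i : ℕ) = m then 1 else 0

theorem stdVec_val (i : Fin 5) : stdVec i = Pi.single i 1 := by
  ext j
  simp [stdVec, Pi.single_apply, Fin.ext_iff]

/-- The vector `∑ c φ(n) e_m`. -/
noncomputable def vecEval (φ : ℕ → ℝ) (w : List (ℕ × ℕ × ℤ)) : V5 :=
  (w.map fun s => ((s.2.2 : ℝ) * φ s.2.1) • stdVec s.1).sum

@[simp] theorem vecEval_nil (φ : ℕ → ℝ) : vecEval φ [] = 0 := rfl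

@[simp] theorem vecEval_cons (φ : ℕ → ℝ) (s : ℕ × ℕ × ℤ) (w : List (ℕ × ℕ × ℤ)) :
    vecEval φ (s :: w) = ((s.2.2 : ℝ) * φ s.2.1) • stdVec s.1 + vecEval φ w := by
  simp [vecEval]

@[simp] theorem vecEval_append (φ : ℕ → ℝ) (w w' : List (ℕ × ℕ × ℤ)) :
    vecEval φ (w ++ w') = vecEval φ w + vecEval φ w' := by simp [vecEval]

/-- The triples `(i, j, l)` of a table of brackets have `i < j < 5` and `l < 5`. -/
def IsTable (T : List (ℕ × ℕ × ℕ)) : Prop := ∀ t ∈ T, t.1 < t.2.1 ∧ t.2.1 < 5 ∧ t.2.2 < 5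

instance (T : List (ℕ × ℕ × ℕ)) : Decidable (IsTable T) := by unfold IsTable; infer_instance

/-- The sum of the `E i j l` for `(i, j, l)` in `T`. -/
def tableSum (T : List (ℕ × ℕ × ℕ)) : AltBracket V5 :=
  (T.map fun t => E (Fin.ofNat 5 t.1) (Fin.ofNat 5 t.2.1) (Fin.ofNat 5 t.2.2)).sum

theorem tableSum_cons (t : ℕ × ℕ × ℕ) (T : List (ℕ × ℕ × ℕ)) : tableSum (t :: T) =
    E (Fin.ofNat 5 t.1) (Fin.ofNat 5 t.2.1) (Fin.ofNat 5 t.2.2) + tableSum T := by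
  simp [tableSum]

theorem stdVec_ofNat {m i : ℕ} (hi : i < 5) :
    stdVec m (Fin.ofNat 5 i) = if m = i then 1 else 0 := by
  simp [stdVec, Nat.mod_eq_of_lt hi, eq_comm]

theorem single_ofNat {i : ℕ} (hi : i < 5) :
    (Pi.single (Fin.ofNat 5 i) 1 : V5) = stdVec i := by
  rw [← stdVec_val]
  simp [Nat.mod_eq_of_lt hi]

theorem vecEval_rmul {T : List (ℕ × ℕ × ℕ)} (hT : IsTable T) (φ : ℕ → ℝ) (y : ℕ)
    (w : List (ℕ × ℕ × ℤ)) :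
    vecEval φ (rmul T y w) = (tableSum T).1 (vecEval φ w) (stdVec y) := by
  induction w with
  | nil => simp [rmul]
  | cons s w ih =>
    obtain ⟨m, n, c⟩ := s
    rw [vecEval_cons, map_add, LinearMap.add_apply, ← ih, map_smul, LinearMap.smul_apply]
    rw [show rmul T y ((m, n, c) :: w) = T.foldr (fun t r =>
      bif Nat.beq m t.1 && Nat.beq y t.2.1 then (t.2.2, n, c) :: r
      else bif Nat.beq m t.2.1 && Nat.beq y t.1 then (t.2.2, n, -c) :: r else r)
        (rmul T y w) from rfl]
    generalize rmul T y w = r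
    clear ih
    induction T with
    | nil => simp [tableSum]
    | cons t T ihT =>
      have ihT := ihT (fun s hs => hT s (List.mem_cons_of_mem _ hs))
      obtain ⟨h1, h2, h3⟩ := hT t List.mem_cons_self
      rw [tableSum_cons, List.foldr_cons]
      simp only [Submodule.coe_add, LinearMap.add_apply, E_apply, stdVec_ofNat h2,
        stdVec_ofNat (h1.trans h2), single_ofNat h3, Bool.cond_eq_ite, Bool.and_eq_true,
        Nat.beq_eq] at ihT ⊢
      -- Since `i < j` in every table entry, at most one of the two orientations of the pair can
      -- match.
      by_cases ha : m = t.1 ∧ y = t.2.1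
      · have hb : ¬ m = t.2.1 := by omega
        rw [if_pos ha, vecEval_cons, ihT, if_pos ha.1, if_pos ha.2, if_neg hb]
        module
      · rw [if_neg ha]
        have ha' : (if m = t.1 then (1 : ℝ) else 0) * (if y = t.2.1 then 1 else 0) = 0 := by
          rcases not_and_or.1 ha with h | h <;> simp [h]
        by_cases hb : m = t.2.1 ∧ y = t.1
        · rw [if_pos hb, vecEval_cons, ihT, ha', if_pos hb.1, if_pos hb.2]
          push_cast
          module
        · have hb' : (if m = t.2.1 then (1 : ℝ) else 0) * (if y = t.1 then 1 else 0) = 0 := by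
            rcases not_and_or.1 hb with h | h <;> simp [h]
          rw [if_neg hb, ihT, ha', hb']
          module

/-- The components occurring in `w` are less than `5`. -/
def IsVec (w : List (ℕ × ℕ × ℤ)) : Prop := ∀ s ∈ w, s.1 < 5

theorem isVec_rmul {T : List (ℕ × ℕ × ℕ)} (hT : IsTable T) (y : ℕ) (w : List (ℕ × ℕ × ℤ)) :
    IsVec (rmul T y w) := by
  induction w with
  | nil => intro s hs; cases hs
  | cons s w ih =>
    obtain ⟨m, n, c⟩ := s
    rw [show rmul T y ((m, n, c) :: w) = T.foldr (fun t r =>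
      bif Nat.beq m t.1 && Nat.beq y t.2.1 then (t.2.2, n, c) :: r
      else bif Nat.beq m t.2.1 && Nat.beq y t.1 then (t.2.2, n, -c) :: r else r)
        (rmul T y w) from rfl]
    generalize rmul T y w = r at ih
    induction T with
    | nil => exact ih
    | cons t T ihT =>
      have ihT := ihT (fun s hs => hT s (List.mem_cons_of_mem _ hs))
      obtain ⟨h1, h2, h3⟩ := hT t List.mem_cons_self
      rw [List.foldr_cons]
      simp only [Bool.cond_eq_ite] at ihT ⊢
      split_ifs
      · exact List.forall_mem_cons.2 ⟨h3, ihT⟩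
      · exact List.forall_mem_cons.2 ⟨h3, ihT⟩
      · exact ihT

/-- The position of the pair `i < j` in the lexicographic order of pairs in `{0, …, 4}`. -/
def pairIdx : ℕ → ℕ → ℕ
  | 0, j => j - 1
  | 1, j => j + 2
  | 2, j => j + 4
  | i, j => i + j + 2

/-- `φ` is the sequence of the coordinates `σ(e_i, e_j)_l`, `i < j`, of `σ`. -/
def IsCoord (φ : ℕ → ℝ) (σ : V5 →ₗ[ℝ] V5 →ₗ[ℝ] V5) : Prop :=
  ∀ i j l : Fin 5, i < j →
    φ (5 * pairIdx i j + l) = σ (Pi.single i 1) (Pi.single j 1) l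

/-- Prepend to `r` the forms `σ ↦ c σ(e_i, e_j)`, for `i < j`. -/
def coordForms (i j : ℕ) (c : ℤ) (r : List (ℕ × ℕ × ℤ)) : List (ℕ × ℕ × ℤ) :=
  [0, 1, 2, 3, 4].foldr (fun l r => (l, 5 * pairIdx i j + l, c) :: r) r

/-- Prepend to `r` the forms `σ ↦ σ(u, e_y)`, for a constant vector `u`. -/
def cochainForms (y : ℕ) : List (ℕ × ℕ × ℤ) → List (ℕ × ℕ × ℤ) → List (ℕ × ℕ × ℤ)
  | [], r => r
  | (m, _, c) :: u, r =>
    bif Nat.blt m y then coordForms m y c (cochainForms y u r)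
    else bif Nat.blt y m then coordForms y m (-c) (cochainForms y u r)
    else cochainForms y u r

theorem vecEval_coordForms {φ : ℕ → ℝ} {σ : V5 →ₗ[ℝ] V5 →ₗ[ℝ] V5} (hφ : IsCoord φ σ)
    (i j : Fin 5) (hij : i < j) (c : ℤ) (r : List (ℕ × ℕ × ℤ)) :
    vecEval φ (coordForms i j c r) =
      (c : ℝ) • σ (Pi.single i 1) (Pi.single j 1) + vecEval φ r := by
  have h := fun l => hφ i j l hij
  simp only [coordForms, List.foldr_cons, List.foldr_nil, vecEval_cons]
  ext l
  have h0 := h 0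
  have h1 := h 1
  have h2 := h 2
  have h3 := h 3
  have h4 := h 4
  norm_num at h0 h1 h2 h3 h4
  fin_cases l <;> simp [stdVec, *]

theorem vecEval_cochainForms {φ : ℕ → ℝ} {σ : V5 →ₗ[ℝ] V5 →ₗ[ℝ] V5} (hφ : IsCoord φ σ)
    (hσ : ∀ x, σ x x = 0) (y : Fin 5) (u r : List (ℕ × ℕ × ℤ)) (hu : IsVec u) :
    vecEval φ (cochainForms y u r) =
      σ (vecEval (fun _ => 1) u) (Pi.single y 1) + vecEval φ r := by
  have skew : ∀ x y, σ x y = - σ y x := fun x y => by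
    have h := hσ (x + y)
    simp only [map_add, LinearMap.add_apply, hσ x, hσ y, zero_add, add_zero] at h
    exact eq_neg_of_add_eq_zero_right h
  induction u with
  | nil => simp [cochainForms]
  | cons s u ih =>
    obtain ⟨m, n, c⟩ := s
    obtain ⟨hm, hu⟩ := List.forall_mem_cons.1 hu
    have ih := ih hu
    lift m to Fin 5 using hm
    rw [vecEval_cons, map_add, LinearMap.add_apply, map_smul, LinearMap.smul_apply, add_assoc,
      ← ih]
    simp only [cochainForms, Bool.cond_eq_ite, Nat.blt_eq, mul_one, stdVec_val]
    split_ifs with h1 h2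
    · exact vecEval_coordForms hφ m y h1 c _
    · rw [vecEval_coordForms hφ y m h2, skew (Pi.single m 1)]
      push_cast
      module
    · obtain rfl : m = y := Fin.ext (by omega)
      rw [hσ, smul_zero, zero_add]

/-- Prepend to `r` the forms `σ ↦ w` obtained from the pair `(u, w)` of values of `N` and `dN` by
`k` further multiplications with basis vectors. -/
def nilForms (T : List (ℕ × ℕ × ℕ)) : ℕ → List (ℕ × ℕ × ℤ) → List (ℕ × ℕ × ℤ) →
    List (List (ℕ × ℕ × ℤ)) → List (List (ℕ × ℕ × ℤ))
  | _, [], [], r => r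
  | 0, _, w, r => w :: r
  | k + 1, u, w, r => [0, 1, 2, 3, 4].foldr (fun y r =>
      nilForms T k (rmul T y u) (cochainForms y u (rmul T y w)) r) r

/-- The pair `(u, w)` of values of `N` and `dN` is sent to a pair `(*, 0)` by any `k`
multiplications with vectors of `s`. -/
def NilPair {V : Type*} [AddCommGroup V] [Module ℝ V] (β σ : V →ₗ[ℝ] V →ₗ[ℝ] V) (s : Set V) :
    ℕ → V → V → Prop
  | 0, _, w => w = 0
  | k + 1, u, w => ∀ y ∈ s, NilPair β σ s k (β u y) (σ u y + β w y)

theorem nilPair_zero {V : Type*} [AddCommGroup V] [Module ℝ V] (β σ : V →ₗ[ℝ] V →ₗ[ℝ] V)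
    (s : Set V) (k : ℕ) : NilPair β σ s k 0 0 := by
  induction k with
  | zero => rfl
  | succ k ih => intro y _; simpa using ih

theorem NilPair.add {V : Type*} [AddCommGroup V] [Module ℝ V] {β σ : V →ₗ[ℝ] V →ₗ[ℝ] V}
    {s : Set V} {k : ℕ} {u w u' w' : V} (h : NilPair β σ s k u w) (h' : NilPair β σ s k u' w') :
    NilPair β σ s k (u + u') (w + w') := by
  induction k generalizing u w u' w' with
  | zero =>
    change w = 0 at h
    change w' = 0 at h'
    change w + w' = 0
    rw [h, h', add_zero]
  | succ k ih =>
    intro y hy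
    have := ih (h y hy) (h' y hy)
    convert this using 1
    · simp
    · simp only [map_add, LinearMap.add_apply]
      abel

theorem NilPair.smul {V : Type*} [AddCommGroup V] [Module ℝ V] {β σ : V →ₗ[ℝ] V →ₗ[ℝ] V}
    {s : Set V} {k : ℕ} {u w : V} (a : ℝ) (h : NilPair β σ s k u w) :
    NilPair β σ s k (a • u) (a • w) := by
  induction k generalizing u w with
  | zero =>
    change w = 0 at h
    change a • w = 0
    rw [h, smul_zero]
  | succ k ih =>
    intro y hy
    have := ih (h y hy)
    convert this using 1
    · simp
    · simp

/-- The condition is linear in the pair `(u, w)`, and one multiplication is linear in its right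
factor, so each argument may be restricted to a spanning set. -/
theorem nilPair_of_span {V : Type*} [AddCommGroup V] [Module ℝ V] {β σ : V →ₗ[ℝ] V →ₗ[ℝ] V}
    {s : Set V} (hs : Submodule.span ℝ s = ⊤) {k : ℕ} {u w : V} (h : NilPair β σ s k u w) :
    NilPair β σ Set.univ k u w := by
  induction k generalizing u w with
  | zero => exact h
  | succ k ih =>
    intro y _
    have hy : y ∈ Submodule.span ℝ s := hs ▸ Submodule.mem_top
    induction hy using Submodule.span_induction with
    | mem y hy => exact ih (h y hy)
    | zero => simpa using nilPair_zero β σ _ k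
    | add y z _ _ hy hz =>
      convert (hy trivial).add (hz trivial) using 1
      · simp
      · simp only [map_add]
        abel
    | smul a y _ hy =>
      convert (hy trivial).smul a using 1
      · simp
      · simp

/-- `dIterN` recurses on the last argument, `NilPair` on the next one to be multiplied. Moving
arguments one at a time from one side to the other makes the two agree; the case `j = 0` is the one
needed. -/
theorem forall_dIterN_eq_zero_iff {V : Type*} [AddCommGroup V] [Module ℝ V]
    (β σ : V →ₗ[ℝ] V →ₗ[ℝ] V) (j k n : ℕ) (hn : n = j + k) :
    (∀ x, dIterN β n σ x = 0) ↔
      ∀ x, NilPair β σ Set.univ k (iterN β j x) (dIterN β j σ x) := by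
  induction k generalizing j with
  | zero => subst hn; rfl
  | succ k ih =>
    rw [ih (j + 1) (by omega)]
    constructor
    · intro h x y _
      have := h (Fin.snoc (α := fun _ => V) x y)
      simpa [iterN, dIterN] using this
    · intro h x
      exact h (Fin.init x) (x (Fin.last _)) trivial

/-- The equation lists are built by functions that prepend to an accumulator; this turns the meaning
of one such function into the meaning of its iteration over a list. -/
theorem forall_mem_foldr {α ι κ : Type*} (Q : α → Prop) (R : ι → Prop) (g : κ → List α → List α)
    (f : ι → κ) (step : ∀ y r, (∀ P ∈ g (f y) r, Q P) ↔ R y ∧ ∀ P ∈ r, Q P) (l : List ι)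
    (r : List α) :
    (∀ P ∈ (l.map f).foldr g r, Q P) ↔ (∀ y ∈ l, R y) ∧ ∀ P ∈ r, Q P := by
  induction l with
  | nil => simp
  | cons y l ih => rw [List.map_cons, List.foldr_cons, step, ih, List.forall_mem_cons, and_assoc]

theorem forall_mem_foldr_five {α : Type*} (Q : α → Prop) (R : Fin 5 → Prop)
    (g : ℕ → List α → List α) (step : ∀ (y : Fin 5) r, (∀ P ∈ g y r, Q P) ↔ R y ∧ ∀ P ∈ r, Q P)
    (r : List α) :
    (∀ P ∈ [0, 1, 2, 3, 4].foldr g r, Q P) ↔ (∀ y, R y) ∧ ∀ P ∈ r, Q P := by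
  rw [show [0, 1, 2, 3, 4] = (List.finRange 5).map Fin.val from rfl,
    forall_mem_foldr Q R g _ step]
  simp

/-- The basis of `V5` as a set. -/
def stdBasisSet : Set V5 := Set.range fun i : Fin 5 => Pi.single i 1

theorem span_stdBasisSet : Submodule.span ℝ stdBasisSet = ⊤ := by
  have h := (Pi.basisFun ℝ (Fin 5)).span_eq
  rwa [show (⇑(Pi.basisFun ℝ (Fin 5)) : Fin 5 → V5) = fun i => Pi.single i 1 from
    funext fun i => Pi.basisFun_apply _ _ i] at h

/-- Symbolic counterpart of `NilPair`: `u` is a constant vector and `w` is linear in `σ`. Stopping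
early at the pair of empty lists loses no equation, since the pair `(0, 0)` always satisfies the
condition. -/
theorem forall_nilForms {T : List (ℕ × ℕ × ℕ)} (hT : IsTable T) {φ : ℕ → ℝ}
    {σ : V5 →ₗ[ℝ] V5 →ₗ[ℝ] V5} (hφ : IsCoord φ σ) (hσ : ∀ x, σ x x = 0) (k : ℕ)
    (u w : List (ℕ × ℕ × ℤ)) (hu : IsVec u) (r : List (List (ℕ × ℕ × ℤ))) :
    (∀ P ∈ nilForms T k u w r, vecEval φ P = 0) ↔
      NilPair (tableSum T).1 σ stdBasisSet k (vecEval (fun _ => 1) u) (vecEval φ w) ∧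
        ∀ P ∈ r, vecEval φ P = 0 := by
  induction k generalizing u w r with
  | zero =>
    unfold nilForms
    split
    · simp [NilPair]
    · simp [NilPair]
    · rename_i h _
      cases h
  | succ k ih =>
    by_cases h : u = [] ∧ w = []
    · obtain ⟨rfl, rfl⟩ := h
      simp [nilForms, nilPair_zero]
    · rw [nilForms.eq_3 _ _ _ _ _ fun h1 h2 => h ⟨h1, h2⟩]
      have step : ∀ (y : Fin 5) (r : List (List (ℕ × ℕ × ℤ))),
          (∀ P ∈ nilForms T k (rmul T y u) (cochainForms y u (rmul T y w)) r, vecEval φ P = 0) ↔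
          NilPair (tableSum T).1 σ stdBasisSet k
            ((tableSum T).1 (vecEval (fun _ => 1) u) (Pi.single y 1))
            (σ (vecEval (fun _ => 1) u) (Pi.single y 1) +
              (tableSum T).1 (vecEval φ w) (Pi.single y 1)) ∧ ∀ P ∈ r, vecEval φ P = 0 := by
        intro y r
        rw [ih _ _ (isVec_rmul hT _ _) r, vecEval_rmul hT, vecEval_cochainForms hφ hσ y _ _ hu,
          vecEval_rmul hT, stdVec_val]
      rw [forall_mem_foldr_five _ _ _ step]
      simp [NilPair, stdBasisSet]

/-- The form giving the component `l` of `w`. -/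
def rowOf (l : ℕ) : List (ℕ × ℕ × ℤ) → List (ℕ × ℤ)
  | [] => []
  | (m, n, c) :: w => bif Nat.beq m l then formInsert n c (rowOf l w) else rowOf l w

/-- Prepend to `r` the components of `w`. -/
def rowsOf (w : List (ℕ × ℕ × ℤ)) (r : List (List (ℕ × ℤ))) : List (List (ℕ × ℤ)) :=
  [0, 1, 2, 3, 4].foldr (fun l r => match rowOf l w with
    | [] => r
    | s => s :: r) r

theorem formEval_rowOf (φ : ℕ → ℝ) (l : Fin 5) (w : List (ℕ × ℕ × ℤ)) :
    formEval φ (rowOf l w) = vecEval φ w l := by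
  induction w with
  | nil => simp [rowOf]
  | cons s w ih =>
    obtain ⟨m, n, c⟩ := s
    simp only [rowOf, Bool.cond_eq_ite, Nat.beq_eq, vecEval_cons, Pi.add_apply, Pi.smul_apply,
      stdVec, ← ih, eq_comm (a := m)]
    split_ifs
    · rw [formEval_insert]
      simp
    · simp

theorem forall_rowsOf (φ : ℕ → ℝ) (w : List (ℕ × ℕ × ℤ)) (r : List (List (ℕ × ℤ))) :
    (∀ s ∈ rowsOf w r, formEval φ s = 0) ↔ vecEval φ w = 0 ∧ ∀ s ∈ r, formEval φ s = 0 := by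
  have step : ∀ (l : Fin 5) (r : List (List (ℕ × ℤ))),
      (∀ s ∈ (match rowOf l w with
        | [] => r
        | s => s :: r), formEval φ s = 0) ↔ vecEval φ w l = 0 ∧ ∀ s ∈ r, formEval φ s = 0 := by
    intro l r
    rw [← formEval_rowOf]
    split
    · rename_i h
      simp [h]
    · simp
  rw [rowsOf, forall_mem_foldr_five _ _ _ step, funext_iff]
  rfl

/-- Prepend to `r` the forms `σ ↦ σ(μ(e_i, e_j), e_k) + μ(σ(e_i, e_j), e_k)`. -/
def jacobiForms (T : List (ℕ × ℕ × ℕ)) (i j k : ℕ) (r : List (ℕ × ℕ × ℤ)) :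
    List (ℕ × ℕ × ℤ) :=
  cochainForms k (rmul T j [(i, 0, 1)]) (rmul T k (cochainForms j [(i, 0, 1)] []) ++ r)

/-- The linear system of the 2-cocycles. -/
def cocycleRows (T : List (ℕ × ℕ × ℕ)) : List (List (ℕ × ℤ)) :=
  [(0, 1, 2), (0, 1, 3), (0, 1, 4), (0, 2, 3), (0, 2, 4), (0, 3, 4), (1, 2, 3), (1, 2, 4),
    (1, 3, 4), (2, 3, 4)].foldr (fun t => rowsOf (jacobiForms T t.1 t.2.1 t.2.2
      (jacobiForms T t.2.1 t.2.2 t.1 (jacobiForms T t.2.2 t.1 t.2.1 [])))) []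

/-- The linear system of the 2-cocycles that are killed by `dN_k`. -/
def nilCocycleRows (T : List (ℕ × ℕ × ℕ)) (k : ℕ) : List (List (ℕ × ℤ)) :=
  ([0, 1, 2, 3, 4].foldr (fun y => nilForms T k [(y, 0, 1)] []) []).foldr rowsOf (cocycleRows T)

end StructureConstants

end NilLie

namespace NilLie

open LieModule.Cohomology

/-! ### Coordinates on the space of 2-cochains -/

section Coordinates

theorem AltBracket.skew {V : Type*} [AddCommGroup V] [Module ℝ V] (σ : AltBracket V) (x y : V) :
    σ.1 x y = -σ.1 y x := by
  have h := σ.2 (x + y)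
  simp only [map_add, LinearMap.add_apply, σ.2 x, σ.2 y, zero_add, add_zero] at h
  exact eq_neg_of_add_eq_zero_right h

theorem linearMap_ext_single {M : Type*} [AddCommGroup M] [Module ℝ M] {f g : V5 →ₗ[ℝ] M}
    (h : ∀ i, f (Pi.single i 1) = g (Pi.single i 1)) : f = g :=
  (Pi.basisFun ℝ (Fin 5)).ext fun i => by simpa using h i

/-- The pairs `i < j` in lexicographic order. -/
def pairOf : Fin 10 → Fin 5 × Fin 5 :=
  ![(0, 1), (0, 2), (0, 3), (0, 4), (1, 2), (1, 3), (1, 4), (2, 3), (2, 4), (3, 4)]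

theorem pairOf_lt : ∀ p, (pairOf p).1 < (pairOf p).2 := by decide

theorem pairOf_injective : Function.Injective pairOf := by decide

theorem exists_pairOf : ∀ i j : Fin 5, i < j → ∃ p : Fin 10, pairOf p = (i, j) ∧
    pairIdx i j = p := by decide

/-- The coordinates `σ(e_i, e_j)_l`, `i < j`. -/
def altCoord : AltBracket V5 →ₗ[ℝ] (Fin 10 × Fin 5 → ℝ) where
  toFun σ q := σ.1 (Pi.single (pairOf q.1).1 1) (Pi.single (pairOf q.1).2 1) q.2
  map_add' _ _ := rfl
  map_smul' _ _ := rfl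

theorem altCoord_E (q : Fin 10 × Fin 5) :
    altCoord (E (pairOf q.1).1 (pairOf q.1).2 q.2) = Pi.single q 1 := by
  ext q'
  obtain ⟨p, l⟩ := q
  obtain ⟨p', l'⟩ := q'
  have h := pairOf_lt p
  have h' := pairOf_lt p'
  simp only [altCoord, LinearMap.coe_mk, AddHom.coe_mk, E_apply, Pi.smul_apply, Pi.single_apply,
    smul_eq_mul, Prod.mk.injEq]
  by_cases hp : p' = p
  · subst hp
    simp [h.ne, h.ne']
  · have h1 : ¬ ((pairOf p).2 = (pairOf p').1 ∧ (pairOf p).1 = (pairOf p').2) := by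
      rintro ⟨h1, h2⟩
      rw [h1, h2] at h
      exact absurd h h'.not_gt
    have h2 : ¬ ((pairOf p).1 = (pairOf p').1 ∧ (pairOf p).2 = (pairOf p').2) := fun h2 =>
      hp (pairOf_injective (Prod.ext h2.1 h2.2)).symm
    simp only [hp, false_and, if_false, mul_ite, mul_one, mul_zero,
      ← ite_and]
    rw [and_comm] at h1 h2
    simp [h1, h2]

theorem altCoord_injective : Function.Injective altCoord := by
  rw [← LinearMap.ker_eq_bot, LinearMap.ker_eq_bot']
  intro σ hσ
  have h : ∀ i j : Fin 5, i < j → σ.1 (Pi.single i 1) (Pi.single j 1) = 0 := by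
    intro i j hij
    obtain ⟨p, hp, -⟩ := exists_pairOf i j hij
    ext l
    have := congrFun hσ (p, l)
    simpa [altCoord, hp] using this
  refine Subtype.ext (linearMap_ext_single fun i => linearMap_ext_single fun j => ?_)
  rcases lt_trichotomy i j with hij | rfl | hij
  · simpa using h i j hij
  · simpa using σ.2 _
  · rw [AltBracket.skew, h j i hij]
    simp

theorem altCoord_surjective : Function.Surjective altCoord := by
  intro x
  refine ⟨∑ q, x q • E (pairOf q.1).1 (pairOf q.1).2 q.2, ?_⟩
  simp only [map_sum, map_smul, altCoord_E]
  ext q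
  simp [Finset.sum_apply, Pi.single_apply]

/-- The coordinates on `Λ²V* ⊗ V`. -/
noncomputable def altEquiv : AltBracket V5 ≃ₗ[ℝ] (Fin 50 → ℝ) :=
  (LinearEquiv.ofBijective altCoord ⟨altCoord_injective, altCoord_surjective⟩).trans
    (LinearEquiv.funCongrLeft ℝ ℝ (finProdFinEquiv (m := 10) (n := 5)).symm)

theorem isCoord_altEquiv (σ : AltBracket V5) : IsCoord (extendZero (altEquiv σ)) σ.1 := by
  intro i j l hij
  obtain ⟨p, hp, h⟩ := exists_pairOf i j hij
  have hlt : 5 * pairIdx i j + l < 50 := by omega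
  -- The numbering by `pairIdx` agrees with that of `finProdFinEquiv`, which sends `(p, l)` to `l +
  -- 5 * p`.
  have hq : (⟨5 * pairIdx i j + l, hlt⟩ : Fin 50) = finProdFinEquiv (m := 10) (n := 5) (p, l) := by
    ext
    change 5 * pairIdx i j + (l : ℕ) = l + 5 * p
    rw [h, add_comm]
  rw [extendZero, dif_pos hlt, hq]
  change altCoord σ ((finProdFinEquiv (m := 10) (n := 5)).symm
    (finProdFinEquiv (m := 10) (n := 5) (p, l))) = _
  rw [Equiv.symm_apply_apply]
  simp [altCoord, hp]

/-- `toCochain` as a linear equivalence. -/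
def toCochainEquiv (μ : lieVariety V5) : AltBracket V5 ≃ₗ[ℝ] twoCochain ℝ (Alg μ) (Alg μ) where
  toFun := toCochain μ
  invFun c := ⟨(show V5 →ₗ[ℝ] V5 →ₗ[ℝ] V5 from c.1), c.2⟩
  map_add' _ _ := rfl
  map_smul' _ _ := rfl
  left_inv _ := rfl
  right_inv _ := rfl

/-- `σ(μ(x, y), z) + μ(σ(x, y), z)`. -/
def jacobiTerm (μ σ : AltBracket V5) (x y z : V5) : V5 :=
  σ.1 (μ.1 x y) z + μ.1 (σ.1 x y) z

/-- The Chevalley–Eilenberg differential is minus the linearisation of the Jacobi expression. -/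
theorem d₂₃_toCochain (μ : lieVariety V5) (σ : AltBracket V5) (x y z : V5) :
    d₂₃ ℝ (Alg μ) (Alg μ) (toCochain μ σ) x y z = -(jacobiTerm μ.1 σ x y z +
      jacobiTerm μ.1 σ y z x + jacobiTerm μ.1 σ z x y) := by
  have h : d₂₃ ℝ (Alg μ) (Alg μ) (toCochain μ σ) x y z =
      μ.1.1 x (σ.1 y z) - μ.1.1 y (σ.1 x z) + μ.1.1 z (σ.1 x y) - σ.1 (μ.1.1 x y) z +
        σ.1 (μ.1.1 x z) y - σ.1 (μ.1.1 y z) x := rfl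
  rw [h, AltBracket.skew μ.1 x (σ.1 y z), AltBracket.skew μ.1 y, AltBracket.skew μ.1 z (σ.1 x y), AltBracket.skew σ x z, AltBracket.skew μ.1 x z]
  simp only [jacobiTerm, map_neg, LinearMap.neg_apply]
  abel

theorem dN_toCochain (μ : lieVariety V5) (σ : AltBracket V5) (k : ℕ) :
    dN (Alg μ) k (toCochain μ σ) = dIterN μ.1.1 k σ.1 := rfl

/-- The linearised Jacobi expression `J` is invariant under cyclic rotation and changes sign under a
transposition, hence is alternating. Being also trilinear, it vanishes as soon as it does on
increasing triples of basis vectors. -/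
theorem toCochain_mem_twoCocycle_iff (μ : lieVariety V5) (σ : AltBracket V5) :
    toCochain μ σ ∈ twoCocycle ℝ (Alg μ) (Alg μ) ↔ ∀ i j k : Fin 5, i < j → j < k →
      jacobiTerm μ.1 σ (Pi.single i 1) (Pi.single j 1) (Pi.single k 1) +
      jacobiTerm μ.1 σ (Pi.single j 1) (Pi.single k 1) (Pi.single i 1) +
      jacobiTerm μ.1 σ (Pi.single k 1) (Pi.single i 1) (Pi.single j 1) = 0 := by
  set J : V5 → V5 → V5 → V5 := fun x y z => jacobiTerm μ.1 σ x y z + jacobiTerm μ.1 σ y z x +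
    jacobiTerm μ.1 σ z x y with hJ
  have hd : ∀ x y z, d₂₃ ℝ (Alg μ) (Alg μ) (toCochain μ σ) x y z = -J x y z :=
    d₂₃_toCochain μ σ
  have hrot : ∀ x y z, J y z x = J x y z := fun x y z => by simp only [hJ]; abel
  have hswap : ∀ x y z, J y x z = -J x y z := fun x y z => by
    simp only [hJ, jacobiTerm]
    rw [AltBracket.skew μ.1 y x, AltBracket.skew σ y x, AltBracket.skew μ.1 x z, AltBracket.skew σ x z, AltBracket.skew μ.1 z y, AltBracket.skew σ z y]
    simp only [map_neg, LinearMap.neg_apply]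
    abel
  have hself : ∀ x z, J x x z = 0 := fun x z => by
    have h := hswap x x z
    exact self_eq_neg.1 h
  rw [mem_twoCocycle_iff]
  constructor
  · intro h i j k _ _
    have := hd (Pi.single i 1) (Pi.single j 1) (Pi.single k 1)
    rw [h] at this
    exact neg_eq_zero.1 this.symm
  · intro h
    suffices hz : ∀ i j k : Fin 5, J (Pi.single i 1) (Pi.single j 1) (Pi.single k 1) = 0 by
      refine linearMap_ext_single (M := V5 →ₗ[ℝ] V5 →ₗ[ℝ] V5) fun i =>
        linearMap_ext_single (M := V5 →ₗ[ℝ] V5) fun j => linearMap_ext_single fun k => ?_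
      exact (hd _ _ _).trans (by rw [hz, neg_zero]; rfl)
    have h' : ∀ i j k : Fin 5, i < j → i < k →
        J (Pi.single i 1) (Pi.single j 1) (Pi.single k 1) = 0 := by
      intro i j k hij hik
      rcases lt_trichotomy j k with hjk | rfl | hjk
      · exact h i j k hij hjk
      · rw [← hrot, hself]
      · rw [← hrot, hswap, ← hrot, ← hrot]
        exact neg_eq_zero.2 (h i k j hik hjk)
    have h'' : ∀ i j k : Fin 5, i < j →
        J (Pi.single i 1) (Pi.single j 1) (Pi.single k 1) = 0 := by
      intro i j k hij
      rcases lt_trichotomy i k with hik | rfl | hik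
      · exact h' i j k hij hik
      · rw [← hrot, ← hrot, hself]
      · rw [← hrot, ← hrot, h' k i j hik (hik.trans hij)]
    intro i j k
    rcases lt_trichotomy i j with hij | rfl | hij
    · exact h'' i j k hij
    · exact hself _ _
    · rw [hswap, h'' j i k hij, neg_zero]

theorem vecEval_unit (φ : ℕ → ℝ) (hφ : φ 0 = 1) (i : Fin 5) :
    vecEval φ [((i : ℕ), 0, 1)] = Pi.single i 1 := by
  simp [stdVec_val, hφ]

theorem vecEval_jacobiForms {T : List (ℕ × ℕ × ℕ)} (hT : IsTable T) {φ : ℕ → ℝ}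
    {σ : AltBracket V5} (hφ : IsCoord φ σ.1) (i j k : Fin 5) (r : List (ℕ × ℕ × ℤ)) :
    vecEval φ (jacobiForms T i j k r) = jacobiTerm (tableSum T) σ (Pi.single i 1) (Pi.single j 1)
      (Pi.single k 1) + vecEval φ r := by
  have hi : IsVec [((i : ℕ), 0, 1)] := by simp [IsVec]
  rw [jacobiForms, vecEval_cochainForms hφ σ.2 k _ _ (isVec_rmul hT _ _), vecEval_append,
    vecEval_rmul hT, vecEval_rmul hT, vecEval_cochainForms hφ σ.2 j _ _ hi,
    vecEval_unit _ rfl, vecEval_nil, add_zero, stdVec_val, stdVec_val, jacobiTerm, add_assoc]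

theorem forall_mem_cocycleRows {T : List (ℕ × ℕ × ℕ)} (hT : IsTable T) {φ : ℕ → ℝ}
    {σ : AltBracket V5} (hφ : IsCoord φ σ.1) :
    (∀ s ∈ cocycleRows T, formEval φ s = 0) ↔ ∀ i j k : Fin 5, i < j → j < k →
      jacobiTerm (tableSum T) σ (Pi.single i 1) (Pi.single j 1) (Pi.single k 1) +
      jacobiTerm (tableSum T) σ (Pi.single j 1) (Pi.single k 1) (Pi.single i 1) +
      jacobiTerm (tableSum T) σ (Pi.single k 1) (Pi.single i 1) (Pi.single j 1) = 0 := by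
  let L : List (Fin 5 × Fin 5 × Fin 5) := [(0, 1, 2), (0, 1, 3), (0, 1, 4), (0, 2, 3), (0, 2, 4),
    (0, 3, 4), (1, 2, 3), (1, 2, 4), (1, 3, 4), (2, 3, 4)]
  have hL : ∀ i j k : Fin 5, (i, j, k) ∈ L ↔ i < j ∧ j < k := by decide
  have step : ∀ (t : Fin 5 × Fin 5 × Fin 5) (r : List (List (ℕ × ℤ))), (∀ s ∈
      rowsOf (jacobiForms T t.1 t.2.1 t.2.2
        (jacobiForms T t.2.1 t.2.2 t.1 (jacobiForms T t.2.2 t.1 t.2.1 []))) r,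
        formEval φ s = 0) ↔
      (jacobiTerm (tableSum T) σ (Pi.single t.1 1) (Pi.single t.2.1 1) (Pi.single t.2.2 1) +
      jacobiTerm (tableSum T) σ (Pi.single t.2.1 1) (Pi.single t.2.2 1) (Pi.single t.1 1) +
      jacobiTerm (tableSum T) σ (Pi.single t.2.2 1) (Pi.single t.1 1) (Pi.single t.2.1 1) = 0) ∧
      ∀ s ∈ r, formEval φ s = 0 := by
    intro t r
    rw [forall_rowsOf, vecEval_jacobiForms hT hφ, vecEval_jacobiForms hT hφ,
      vecEval_jacobiForms hT hφ, vecEval_nil, add_zero, add_assoc]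
  have h := forall_mem_foldr (fun s => formEval φ s = 0) _
    (fun t : ℕ × ℕ × ℕ => rowsOf (jacobiForms T t.1 t.2.1 t.2.2
      (jacobiForms T t.2.1 t.2.2 t.1 (jacobiForms T t.2.2 t.1 t.2.1 []))))
    (fun t : Fin 5 × Fin 5 × Fin 5 => ((t.1 : ℕ), (t.2.1 : ℕ), (t.2.2 : ℕ))) step L []
  refine h.trans ⟨fun h i j k h1 h2 => h.1 (i, j, k) ((hL i j k).2 ⟨h1, h2⟩), fun h => ⟨?_, ?_⟩⟩
  · rintro ⟨i, j, k⟩ ht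
    have := (hL i j k).1 ht
    exact h i j k this.1 this.2
  · simp

theorem NilPair.mono {V : Type*} [AddCommGroup V] [Module ℝ V] {β σ : V →ₗ[ℝ] V →ₗ[ℝ] V}
    {s t : Set V} (hst : s ⊆ t) {k : ℕ} {u w : V} (h : NilPair β σ t k u w) :
    NilPair β σ s k u w := by
  induction k generalizing u w with
  | zero => exact h
  | succ k ih => exact fun y hy => ih (h y (hst hy))

theorem toCochain_mem_nilCocycle_iff {T : List (ℕ × ℕ × ℕ)} (hT : IsTable T) (μ : lieVariety V5)
    (hμ : μ.1 = tableSum T) (k : ℕ) (σ : AltBracket V5) :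
    toCochain μ σ ∈ nilCocycle (Alg μ) k ↔ altEquiv σ ∈ solutions 50 (nilCocycleRows T k) := by
  have hφ := isCoord_altEquiv σ
  have hr : ∀ l : List (List (ℕ × ℕ × ℤ)),
      (∀ s ∈ l.foldr rowsOf (cocycleRows T), formEval (extendZero (altEquiv σ)) s = 0) ↔
      (∀ P ∈ l, vecEval (extendZero (altEquiv σ)) P = 0) ∧
        ∀ s ∈ cocycleRows T, formEval (extendZero (altEquiv σ)) s = 0 := by
    intro l
    induction l with
    | nil => simp
    | cons w l ih => rw [List.foldr_cons, forall_rowsOf, ih, List.forall_mem_cons, and_assoc]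
  rw [nilCocycle, Submodule.mem_inf, toCochain_mem_twoCocycle_iff, mem_solutions, nilCocycleRows,
    hr, forall_mem_cocycleRows hT hφ, hμ, and_comm]
  refine and_congr_left fun _ => ?_
  rw [LinearMap.mem_ker, dN_toCochain, hμ, forall_mem_foldr_five _ _ _ fun y r =>
    forall_nilForms hT hφ σ.2 k [((y : ℕ), 0, 1)] [] (by simp [IsVec]) r]
  refine (funext_iff (f := dIterN (tableSum T).1 k σ.1)).trans ?_
  -- With no multiplication done, `N_0` is the first argument and `dN_0` is zero, so the iteration
  -- starts from the pairs `(x 0, 0)`.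
  refine (forall_dIterN_eq_zero_iff (tableSum T).1 σ.1 0 k k (zero_add k).symm).trans ?_
  simp only [vecEval_unit (fun _ => 1) rfl, vecEval_nil, iterN, dIterN, LinearMap.zero_apply,
    Pi.zero_apply]
  refine ⟨fun h => ⟨fun y => (h fun _ => Pi.single y 1).mono (Set.subset_univ _), by simp⟩,
    fun h x => nilPair_of_span span_stdBasisSet ?_⟩
  have hx : x 0 ∈ Submodule.span ℝ stdBasisSet := span_stdBasisSet ▸ Submodule.mem_top
  generalize x 0 = v at hx
  induction hx using Submodule.span_induction with
  | mem v hv => obtain ⟨y, rfl⟩ := hv; exact h.1 y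
  | zero => exact nilPair_zero _ _ _ _
  | add v w _ _ hv hw => simpa using hv.add hw
  | smul a v _ hv => simpa using hv.smul a

theorem finrank_nilCocycle {T : List (ℕ × ℕ × ℕ)} (hT : IsTable T) (μ : lieVariety V5)
    (hμ : μ.1 = tableSum T) (k f r : ℕ) (h : formRank 50 f (nilCocycleRows T k) = some r) :
    Module.finrank ℝ (nilCocycle (Alg μ) k) + r = 50 := by
  rw [← finrank_solutions f _ r h]
  have he : (nilCocycle (Alg μ) k).map
      ((toCochainEquiv μ).symm.trans altEquiv : twoCochain ℝ (Alg μ) (Alg μ) →ₗ[ℝ] _) =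
      solutions 50 (nilCocycleRows T k) := by
    ext x
    obtain ⟨σ, rfl⟩ := altEquiv.surjective x
    rw [← toCochain_mem_nilCocycle_iff hT μ hμ, Submodule.mem_map_equiv]
    rw [LinearEquiv.symm_trans_apply, LinearEquiv.symm_apply_apply]
    rfl
  rw [← he, LinearEquiv.finrank_map_eq]

end Coordinates

end NilLie

namespace NilLie

open LieModule.Cohomology

/-! ### Coboundaries -/

section Coboundaries

/-- Differentiating the equivariance of `N_k` along the orbit of the bracket: `dN_k(d¹f)(x) +
f(N_k(x))` is the sum over `i` of the values of `N_k` with `x_i` replaced by `f(x_i)`. Membership in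
the span of the values of `N_k` is all that is needed and suits the induction. -/
theorem dIterN_d₁₂_add_mem {L : Type*} [LieRing L] [LieAlgebra ℝ L] (f : L →ₗ[ℝ] L) (k : ℕ)
    (x : Fin (k + 1) → L) :
    dIterN (LieAlgebra.ad ℝ L : L →ₗ[ℝ] Module.End ℝ L) k (d₁₂ ℝ L L f).1 x +
        f (iterN (LieAlgebra.ad ℝ L : L →ₗ[ℝ] Module.End ℝ L) k x) ∈
      Submodule.span ℝ (Set.range (iterN (LieAlgebra.ad ℝ L : L →ₗ[ℝ] Module.End ℝ L) k)) := by
  set β : L →ₗ[ℝ] L →ₗ[ℝ] L := (LieAlgebra.ad ℝ L : L →ₗ[ℝ] Module.End ℝ L) with hβ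
  have hb : ∀ u v, β u v = ⁅u, v⁆ := fun _ _ => rfl
  induction k with
  | zero =>
    refine Submodule.subset_span ⟨fun _ => f (x 0), ?_⟩
    simp [iterN, dIterN]
  | succ k ih =>
    have hle : ∀ y, Submodule.span ℝ (Set.range (iterN β k)) ≤
        (Submodule.span ℝ (Set.range (iterN β (k + 1)))).comap (β.flip y) := by
      intro y
      rw [Submodule.span_le]
      rintro _ ⟨z, rfl⟩
      refine Submodule.subset_span ⟨Fin.snoc (α := fun _ => L) z y, ?_⟩
      simp [iterN]
    set u := iterN β k (Fin.init x) with hu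
    set y := x (Fin.last (k + 1))
    have h1 := hle y (ih (Fin.init x))
    have h2 := hle (f y) (Submodule.subset_span ⟨Fin.init x, rfl⟩)
    convert Submodule.add_mem (Submodule.span ℝ (Set.range (iterN β (k + 1)))) h2 h1 using 1
    change (d₁₂ ℝ L L f).1 u y + β (dIterN β k _ (Fin.init x)) y + f (β u y) =
      β u (f y) + β (dIterN β k _ (Fin.init x) + f u) y
    have h3 : (d₁₂ ℝ L L f).1 u y = ⁅u, f y⁆ - ⁅y, f u⁆ - f ⁅u, y⁆ := rfl
    rw [h3, map_add, LinearMap.add_apply, hb, hb, hb, hb, ← lie_skew (f u) y]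
    abel

theorem coboundary_le_nilCocycle (L : Type*) [LieRing L] [LieAlgebra ℝ L] (k : ℕ)
    (h : ∀ x, iterN (LieAlgebra.ad ℝ L : L →ₗ[ℝ] Module.End ℝ L) k x = 0) :
    coboundary L ≤ nilCocycle L k := by
  rintro _ ⟨f, rfl⟩
  refine ⟨?_, ?_⟩
  · exact (mem_twoCocycle_iff _ _ _ _).2 (LinearMap.congr_fun (d₂₃_comp_d₁₂ ℝ L L) f)
  · refine LinearMap.mem_ker.2 (funext fun x => ?_)
    have hx := dIterN_d₁₂_add_mem f k x
    rw [h x, map_zero, add_zero, Submodule.span_eq_bot.2 (by rintro _ ⟨z, rfl⟩; exact h z)] at hx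
    exact hx

theorem finrank_H2nil {L : Type*} [LieRing L] [LieAlgebra ℝ L] [FiniteDimensional ℝ L] {k : ℕ}
    (h : coboundary L ≤ nilCocycle L k) :
    Module.finrank ℝ (H2nil L k) + Module.finrank ℝ (coboundary L) =
      Module.finrank ℝ (nilCocycle L k) := by
  rw [← Submodule.finrank_quotient_add_finrank ((coboundary L).submoduleOf (nilCocycle L k)),
    (Submodule.submoduleOfEquivOfLe h).finrank_eq]

/-- Prepend to `r` the forms `f ↦ c f(e_i)`. -/
def imageForms (c : ℤ) (i : ℕ) (r : List (ℕ × ℕ × ℤ)) : List (ℕ × ℕ × ℤ) :=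
  [0, 1, 2, 3, 4].foldr (fun m r => (m, 5 * i + m, c) :: r) r

/-- The forms `f ↦ f(u)`. -/
def applyForms : List (ℕ × ℕ × ℤ) → List (ℕ × ℕ × ℤ)
  | [] => []
  | (m, _, c) :: u => imageForms c m (applyForms u)

/-- The linear system of the derivations. -/
def derivationRows (T : List (ℕ × ℕ × ℕ)) : List (List (ℕ × ℤ)) :=
  [0, 1, 2, 3, 4].foldr (fun i r => [0, 1, 2, 3, 4].foldr (fun j r =>
    rowsOf (rmul T i (imageForms 1 j []) ++ (rmul T j (imageForms (-1) i []) ++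
      applyForms (rmul T j [(i, 0, 1)]))) r) r) []

/-- `φ` is the sequence of the coordinates `f(e_i)_m`. -/
def IsCoordEnd (φ : ℕ → ℝ) (f : V5 →ₗ[ℝ] V5) : Prop :=
  ∀ i m : Fin 5, φ (5 * i + m) = f (Pi.single i 1) m

theorem vecEval_imageForms {φ : ℕ → ℝ} {f : V5 →ₗ[ℝ] V5} (hφ : IsCoordEnd φ f) (c : ℤ) (i : Fin 5)
    (r : List (ℕ × ℕ × ℤ)) :
    vecEval φ (imageForms c i r) = (c : ℝ) • f (Pi.single i 1) + vecEval φ r := by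
  simp only [imageForms, List.foldr_cons, List.foldr_nil, vecEval_cons]
  ext l
  have h0 := hφ i 0
  have h1 := hφ i 1
  have h2 := hφ i 2
  have h3 := hφ i 3
  have h4 := hφ i 4
  norm_num at h0 h1 h2 h3 h4
  fin_cases l <;> simp [stdVec, *]

theorem vecEval_applyForms {φ : ℕ → ℝ} {f : V5 →ₗ[ℝ] V5} (hφ : IsCoordEnd φ f)
    (u : List (ℕ × ℕ × ℤ)) (hu : IsVec u) :
    vecEval φ (applyForms u) = f (vecEval (fun _ => 1) u) := by
  induction u with
  | nil => simp [applyForms]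
  | cons s u ih =>
    obtain ⟨m, n, c⟩ := s
    obtain ⟨hm, hu'⟩ := List.forall_mem_cons.1 hu
    have ih := ih hu'
    lift m to Fin 5 using hm
    rw [applyForms, vecEval_imageForms hφ, ih, vecEval_cons, map_add, map_smul, mul_one,
      stdVec_val]

theorem forall_mem_derivationRows {T : List (ℕ × ℕ × ℕ)} (hT : IsTable T) (μ : lieVariety V5)
    (hμ : μ.1 = tableSum T) {φ : ℕ → ℝ} {f : V5 →ₗ[ℝ] V5} (hφ : IsCoordEnd φ f) :
    (∀ s ∈ derivationRows T, formEval φ s = 0) ↔ d₁₂ ℝ (Alg μ) (Alg μ) f = 0 := by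
  let δ : V5 → V5 → V5 := fun x y => μ.1.1 (f y) x - μ.1.1 (f x) y + f (μ.1.1 x y)
  have hd : ∀ x y : V5, (d₁₂ ℝ (Alg μ) (Alg μ) f).1 x y = -δ x y := by
    intro x y
    have h : (d₁₂ ℝ (Alg μ) (Alg μ) f).1 x y = μ.1.1 x (f y) - μ.1.1 y (f x) - f (μ.1.1 x y) := rfl
    rw [h, AltBracket.skew μ.1 x (f y), AltBracket.skew μ.1 y (f x)]
    simp only [δ]
    abel
  have step : ∀ (i j : Fin 5) (r : List (List (ℕ × ℤ))), (∀ s ∈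
      rowsOf (rmul T i (imageForms 1 j []) ++ (rmul T j (imageForms (-1) i []) ++
        applyForms (rmul T j [((i : ℕ), 0, 1)]))) r, formEval φ s = 0) ↔
      δ (Pi.single i 1) (Pi.single j 1) = 0 ∧ ∀ s ∈ r, formEval φ s = 0 := by
    intro i j r
    rw [forall_rowsOf, vecEval_append, vecEval_append, vecEval_rmul hT, vecEval_rmul hT,
      vecEval_applyForms hφ _ (isVec_rmul hT _ _), vecEval_rmul hT, vecEval_imageForms hφ,
      vecEval_imageForms hφ, vecEval_unit _ rfl, stdVec_val, stdVec_val]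
    simp only [δ, hμ]
    simp [sub_eq_add_neg, add_assoc]
  have h := forall_mem_foldr_five (fun s => formEval φ s = 0) _
    (fun i r => [0, 1, 2, 3, 4].foldr (fun j r =>
      rowsOf (rmul T i (imageForms 1 j []) ++ (rmul T j (imageForms (-1) i []) ++
        applyForms (rmul T j [(i, 0, 1)]))) r) r) (fun i =>
    forall_mem_foldr_five (fun s => formEval φ s = 0) _ (fun j r =>
      rowsOf (rmul T i (imageForms 1 j []) ++ (rmul T j (imageForms (-1) i []) ++
        applyForms (rmul T j [((i : ℕ), 0, 1)]))) r) (step i)) []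
  refine h.trans ⟨fun h => Subtype.ext ?_, fun h => ⟨fun i j => ?_, by simp⟩⟩
  · exact linearMap_ext_single (M := V5 →ₗ[ℝ] V5) fun i => linearMap_ext_single fun j =>
      (hd _ _).trans (neg_eq_zero.2 (h.1 i j))
  · have := hd (Pi.single i 1) (Pi.single j 1)
    rw [h] at this
    exact neg_eq_zero.1 this.symm

/-- The coordinates `f(e_i)_m`. -/
def endCoord : (V5 →ₗ[ℝ] V5) →ₗ[ℝ] (Fin 25 → ℝ) where
  toFun f n := f (Pi.single (finProdFinEquiv (m := 5) (n := 5) |>.symm n).1 1)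
    (finProdFinEquiv (m := 5) (n := 5) |>.symm n).2
  map_add' _ _ := rfl
  map_smul' _ _ := rfl

theorem isCoordEnd_endCoord (f : V5 →ₗ[ℝ] V5) : IsCoordEnd (extendZero (endCoord f)) f := by
  intro i m
  have hlt : 5 * (i : ℕ) + m < 25 := by omega
  have hq : (⟨5 * i + m, hlt⟩ : Fin 25) = finProdFinEquiv (m := 5) (n := 5) (i, m) := by
    ext
    change 5 * (i : ℕ) + (m : ℕ) = m + 5 * i
    rw [add_comm]
  rw [extendZero, dif_pos hlt, hq]
  simp only [endCoord, LinearMap.coe_mk, AddHom.coe_mk, Equiv.symm_apply_apply]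

theorem endCoord_injective : Function.Injective endCoord := by
  rw [← LinearMap.ker_eq_bot, LinearMap.ker_eq_bot']
  intro f hf
  refine linearMap_ext_single fun i => funext fun m => ?_
  rw [← isCoordEnd_endCoord f i m, hf]
  simp [extendZero]

/-- The kernel of `d¹` is the space of derivations, so its rank is 25 minus the dimension of the
solution space, which is the rank of the derivation system itself. -/
theorem finrank_coboundary {T : List (ℕ × ℕ × ℕ)} (hT : IsTable T) (μ : lieVariety V5)
    (hμ : μ.1 = tableSum T) (f r : ℕ) (h : formRank 25 f (derivationRows T) = some r) :
    Module.finrank ℝ (coboundary (Alg μ)) = r := by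
  have h1 := finrank_solutions f _ r h
  have hdim : Module.finrank ℝ (V5 →ₗ[ℝ] V5) = Module.finrank ℝ (Fin 25 → ℝ) := by
    simp [Module.finrank_linearMap]
  let Φ : (V5 →ₗ[ℝ] V5) ≃ₗ[ℝ] (Fin 25 → ℝ) :=
    LinearEquiv.ofBijective endCoord ⟨endCoord_injective,
      (LinearMap.injective_iff_surjective_of_finrank_eq_finrank hdim).1 endCoord_injective⟩
  let D : (V5 →ₗ[ℝ] V5) →ₗ[ℝ] twoCochain ℝ (Alg μ) (Alg μ) := d₁₂ ℝ (Alg μ) (Alg μ)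
  have he : (LinearMap.ker D).map (Φ : (V5 →ₗ[ℝ] V5) →ₗ[ℝ] (Fin 25 → ℝ)) =
      solutions 25 (derivationRows T) := by
    ext x
    obtain ⟨g, rfl⟩ := Φ.surjective x
    rw [Submodule.mem_map_equiv, LinearEquiv.symm_apply_apply, mem_solutions]
    exact (forall_mem_derivationRows hT μ hμ (isCoordEnd_endCoord g)).symm
  rw [← he, LinearEquiv.finrank_map_eq] at h1
  have h2 := LinearMap.finrank_range_add_finrank_ker D
  rw [hdim, Module.finrank_fin_fun] at h2
  change Module.finrank ℝ (LinearMap.range D) = r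
  omega

end Coboundaries

end NilLie

namespace NilLie

open LieModule.Cohomology

/-! ### The table -/

section TableRows

instance (μ : lieVariety V5) : FiniteDimensional ℝ (Alg μ) :=
  inferInstanceAs (FiniteDimensional ℝ V5)

theorem nilVariety_mono {V : Type*} [AddCommGroup V] [Module ℝ V] :
    Monotone (nilVariety V) :=
  monotone_nat_of_le_succ fun k μ h => ⟨h.1, fun x => by
    rw [iterN, h.2 (Fin.init x), map_zero, LinearMap.zero_apply]⟩

/-- One nonzero value of `N_k` and the inclusions between the nilpotent varieties exclude every step
up to `k`. The numbers are then two ranks, found by evaluation, with 1000 as a bound on the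
elimination steps. -/
theorem tableRow_of_ranks (T : List (ℕ × ℕ × ℕ)) {μ : lieVariety V5} {k h z b : ℕ}
    (hμ : μ.1 = tableSum T) (hk : ∀ x, iterN μ.1.1 (k + 1) x = 0)
    (hk' : ∃ x, iterN μ.1.1 k x ≠ 0) (hT : IsTable T)
    (hz : (formRank 50 1000 (nilCocycleRows T (k + 1))).map (· + z) = some 50)
    (hb : formRank 25 1000 (derivationRows T) = some b) (hbz : h + b = z) :
    TableRow μ (k + 1) h z b := by
  obtain ⟨r, hr, hrz⟩ := Option.map_eq_some_iff.1 hz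
  have h1 := finrank_nilCocycle hT μ hμ (k + 1) 1000 _ hr
  have h2 := finrank_coboundary hT μ hμ 1000 _ hb
  have h3 := finrank_H2nil (coboundary_le_nilCocycle (Alg μ) (k + 1) hk)
  refine ⟨⟨μ.2, hk⟩, fun j hj hmem => ?_, by omega, h2, by omega⟩
  obtain ⟨x, hx⟩ := hk'
  exact hx ((nilVariety_mono (Nat.lt_succ_iff.1 hj) hmem).2 x)

theorem tableRow_f3R2 : TableRow f3R2 2 11 20 9 := by
  refine tableRow_of_ranks [(0, 1, 2)] ?_ (fun x => ?_)
    ⟨![Pi.single 0 1, Pi.single 1 1], ?_⟩ (by decide) (by decide +kernel)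
    (by decide +kernel) rfl
  · simp only [tableSum, List.map_cons, List.map_nil, List.sum_cons, List.sum_nil, add_zero]
    rfl
  · simp [iterN, f3R2, E_apply]
  · simp [iterN, f3R2, E_apply, Fin.init]

theorem tableRow_g51 : TableRow g51 2 0 10 10 := by
  refine tableRow_of_ranks [(0, 1, 4), (2, 3, 4)] ?_ (fun x => ?_)
    ⟨![Pi.single 0 1, Pi.single 1 1], ?_⟩ (by decide) (by decide +kernel)
    (by decide +kernel) rfl
  · simp only [tableSum, List.map_cons, List.map_nil, List.sum_cons, List.sum_nil, add_zero]
    rfl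
  · simp [iterN, g51, E_apply]
  · simp [iterN, g51, E_apply, Fin.init]

theorem tableRow_g52 : TableRow g52 2 0 12 12 := by
  refine tableRow_of_ranks [(0, 1, 3), (0, 2, 4)] ?_ (fun x => ?_)
    ⟨![Pi.single 0 1, Pi.single 1 1], ?_⟩ (by decide) (by decide +kernel)
    (by decide +kernel) rfl
  · simp only [tableSum, List.map_cons, List.map_nil, List.sum_cons, List.sum_nil, add_zero]
    rfl
  · simp [iterN, g52, E_apply]
  · simp [iterN, g52, E_apply, Fin.init]

theorem tableRow_f4R : TableRow f4R 3 4 18 14 := by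
  refine tableRow_of_ranks [(0, 1, 2), (0, 2, 3)] ?_ (fun x => ?_)
    -- The double bracket `⁅⁅a, b⁆, a⁆` equals `-d`.
    ⟨![Pi.single 0 1, Pi.single 1 1, Pi.single 0 1], ?_⟩ (by decide) (by decide +kernel)
    (by decide +kernel) rfl
  · simp only [tableSum, List.map_cons, List.map_nil, List.sum_cons, List.sum_nil, add_zero]
    rfl
  · simp [iterN, f4R, E_apply]
  · simp [iterN, f4R, E_apply, Fin.init]

theorem tableRow_g53 : TableRow g53 3 2 17 15 := by
  refine tableRow_of_ranks [(0, 1, 3), (0, 3, 4), (1, 2, 4)] ?_ (fun x => ?_)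
    ⟨![Pi.single 0 1, Pi.single 1 1, Pi.single 0 1], ?_⟩ (by decide) (by decide +kernel)
    (by decide +kernel) rfl
  · simp only [tableSum, List.map_cons, List.map_nil, List.sum_cons, List.sum_nil, add_zero,
      ← add_assoc]
    rfl
  · simp [iterN, g53, E_apply]
  · simp [iterN, g53, E_apply, Fin.init]

theorem tableRow_g54 : TableRow g54 3 0 15 15 := by
  refine tableRow_of_ranks [(0, 1, 2), (0, 2, 3), (1, 2, 4)] ?_ (fun x => ?_)
    ⟨![Pi.single 0 1, Pi.single 1 1, Pi.single 0 1], ?_⟩ (by decide) (by decide +kernel)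
    (by decide +kernel) rfl
  · simp only [tableSum, List.map_cons, List.map_nil, List.sum_cons, List.sum_nil, add_zero,
      ← add_assoc]
    rfl
  · simp [iterN, g54, E_apply]
  · simp [iterN, g54, E_apply, Fin.init]

theorem tableRow_f5 : TableRow f5 4 1 17 16 := by
  refine tableRow_of_ranks [(0, 1, 2), (0, 2, 3), (0, 3, 4)] ?_ (fun x => ?_)
    ⟨![Pi.single 0 1, Pi.single 1 1, Pi.single 0 1, Pi.single 0 1], ?_⟩ (by decide) (by decide +kernel)
    (by decide +kernel) rfl
  · simp only [tableSum, List.map_cons, List.map_nil, List.sum_cons, List.sum_nil, add_zero,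
      ← add_assoc]
    rfl
  · simp [iterN, f5, E_apply]
  · simp [iterN, f5, E_apply, Fin.init]

theorem tableRow_g56 : TableRow g56 4 0 17 17 := by
  refine tableRow_of_ranks [(0, 1, 2), (0, 2, 3), (0, 3, 4), (1, 2, 4)] ?_ (fun x => ?_)
    ⟨![Pi.single 0 1, Pi.single 1 1, Pi.single 0 1, Pi.single 0 1], ?_⟩ (by decide) (by decide +kernel)
    (by decide +kernel) rfl
  · simp only [tableSum, List.map_cons, List.map_nil, List.sum_cons, List.sum_nil, add_zero,
      ← add_assoc]
    rfl
  · simp [iterN, g56, E_apply]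
  · simp [iterN, g56, E_apply, Fin.init]

end TableRows

end NilLie

namespace NilLie

open LieModule.Cohomology

/-! ### The deformations of `𝔤₅,₃` -/

section Deformations

theorem toCochain_mem_nilCocycle {μ : lieVariety V5} {σ : AltBracket V5} {k : ℕ}
    (h : ∀ x y z, jacobiTerm μ.1 σ x y z + jacobiTerm μ.1 σ y z x + jacobiTerm μ.1 σ z x y = 0)
    (h' : ∀ x, dIterN μ.1.1 k σ.1 x = 0) : toCochain μ σ ∈ nilCocycle (Alg μ) k :=
  ⟨(toCochain_mem_twoCocycle_iff μ σ).2 fun _ _ _ _ _ => h _ _ _, funext h'⟩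

theorem jacobiTerm_nu1 (x y z : V5) : jacobiTerm g53.1 nu1 x y z + jacobiTerm g53.1 nu1 y z x +
    jacobiTerm g53.1 nu1 z x y = 0 := by
  ext m
  fin_cases m <;> simp [jacobiTerm, g53, nu1, E_apply] <;> ring

theorem jacobiTerm_nu2 (x y z : V5) : jacobiTerm g53.1 nu2 x y z + jacobiTerm g53.1 nu2 y z x +
    jacobiTerm g53.1 nu2 z x y = 0 := by
  ext m
  fin_cases m <;> simp [jacobiTerm, g53, nu2, E_apply] <;> ring

theorem nu1_mem : toCochain g53 nu1 ∈ nilCocycle (Alg g53) 3 := by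
  refine toCochain_mem_nilCocycle jacobiTerm_nu1 fun x => ?_
  ext m
  fin_cases m <;> simp [dIterN, iterN, g53, nu1, E_apply]

theorem nu2_mem : toCochain g53 nu2 ∈ nilCocycle (Alg g53) 3 := by
  refine toCochain_mem_nilCocycle jacobiTerm_nu2 fun x => ?_
  ext m
  fin_cases m <;> simp [dIterN, iterN, g53, nu2, E_apply] <;> ring

/-- The Jacobi expression is quadratic: at `μ + t • ν` its constant and `t ^ 2` terms are those of
`μ` and `ν`, and its linear term is the cocycle condition. -/
theorem add_smul_mem_lieVariety {μ ν : AltBracket V5} (hμ : μ ∈ lieVariety V5)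
    (hν : ν ∈ lieVariety V5) (h : ∀ x y z, jacobiTerm μ ν x y z + jacobiTerm μ ν y z x +
      jacobiTerm μ ν z x y = 0) (t : ℝ) : μ + t • ν ∈ lieVariety V5 := by
  intro x y z
  have h1 := hμ x y z
  have h2 := hν x y z
  have h3 := h x y z
  simp only [jacobiTerm] at h3
  simp only [Submodule.coe_add, Submodule.coe_smul, LinearMap.add_apply, LinearMap.smul_apply,
    map_add, map_smul]
  linear_combination (norm := module) h1 + t • h3 + t ^ 2 • h2

theorem eq_zero_of_mem_coboundary {s t : ℝ}
    (h : toCochain g53 (s • nu1 + t • nu2) ∈ coboundary (Alg g53)) : s = 0 ∧ t = 0 := by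
  obtain ⟨f, hf⟩ := h
  let f' : V5 →ₗ[ℝ] V5 := f
  have key : ∀ x y : V5, g53.1.1 x (f' y) - g53.1.1 y (f' x) - f' (g53.1.1 x y) =
      s • nu1.1 x y + t • nu2.1 x y := fun x y =>
    congrArg (fun σ : twoCochain ℝ (Alg g53) (Alg g53) => (σ.1 x y : V5)) hf
  -- Brackets of `g53` have no `c`-component. As `⁅b, c⁆ = ⁅a, d⁆ = e`, the `c`-component of `-f(e)`
  -- equals both `s` and `0`; as `⁅a, c⁆ = 0`, the pair `(a, c)` gives `0 = -t`.
  have hbc := congrFun (key (Pi.single 1 1) (Pi.single 2 1)) 2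
  have had := congrFun (key (Pi.single 0 1) (Pi.single 3 1)) 2
  have hac := congrFun (key (Pi.single 0 1) (Pi.single 2 1)) 2
  simp [g53, nu1, nu2, E_apply] at hbc had hac
  constructor <;> linarith

theorem span_classes : Submodule.span ℝ {H2nil.mk (Alg g53) 3 ⟨_, nu1_mem⟩,
    H2nil.mk (Alg g53) 3 ⟨_, nu2_mem⟩} = ⊤ := by
  have hli : LinearIndependent ℝ ![H2nil.mk (Alg g53) 3 ⟨_, nu1_mem⟩,
      H2nil.mk (Alg g53) 3 ⟨_, nu2_mem⟩] := by
    rw [LinearIndependent.pair_iff]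
    intro s t h
    refine eq_zero_of_mem_coboundary ?_
    let c : nilCocycle (Alg g53) 3 :=
      s • ⟨toCochain g53 nu1, nu1_mem⟩ + t • ⟨toCochain g53 nu2, nu2_mem⟩
    exact (Submodule.Quotient.mk_eq_zero ((coboundary (Alg g53)).submoduleOf
      (nilCocycle (Alg g53) 3)) (x := c)).1 h
  have h := hli.span_eq_top_of_card_eq_finrank' (by
    rw [tableRow_g53.2.2.2.2]
    rfl)
  rwa [Matrix.range_cons, Matrix.range_cons, Matrix.range_empty, Set.union_empty,
    Set.singleton_union] at h

theorem isSolvable_of_flag {L : Type*} [LieRing L] [LieAlgebra ℝ L] (S : ℕ → Submodule ℝ L)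
    (h0 : S 0 = ⊤) (h : ∀ n, ∀ x ∈ S n, ∀ y ∈ S n, ⁅x, y⁆ ∈ S (n + 1)) {k : ℕ} (hk : S k = ⊥) :
    LieAlgebra.IsSolvable L := by
  have hD : ∀ n, (LieAlgebra.derivedSeries ℝ L n).toSubmodule ≤ S n := by
    intro n
    induction n with
    | zero => rw [h0]; exact le_top
    | succ n ih =>
      rw [LieAlgebra.derivedSeries_def, LieAlgebra.derivedSeriesOfIdeal_succ,
        LieSubmodule.lieIdeal_oper_eq_linear_span', Submodule.span_le]
      rintro _ ⟨x, hx, y, hy, rfl⟩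
      exact h n x (ih hx) y (ih hy)
  refine (LieAlgebra.isSolvable_iff ℝ L).2 ⟨k, ?_⟩
  exact (LieSubmodule.toSubmodule_eq_bot _).1 (eq_bot_iff.2 (hk ▸ hD k))

/-- The flag is `V ⊇ ⟨b, c, d, e⟩ ⊇ ⟨c, e⟩ ⊇ 0`; it serves both deformations for all values of `t`.
-/
theorem isSolvable_of_flag_V5 (μ : lieVariety V5) (h1 : ∀ x y, μ.1.1 x y 0 = 0)
    (h2 : ∀ x y : V5, x 0 = 0 → y 0 = 0 →
      μ.1.1 x y 1 = 0 ∧ μ.1.1 x y 3 = 0)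
    (h3 : ∀ x y : V5, x 0 = 0 → x 1 = 0 → x 3 = 0 → y 0 = 0 → y 1 = 0 → y 3 = 0 →
      μ.1.1 x y = 0) : LieAlgebra.IsSolvable (Alg μ) := by
  let p : Fin 5 → Submodule ℝ V5 := fun i => LinearMap.ker (LinearMap.proj i : V5 →ₗ[ℝ] ℝ)
  let S : ℕ → Submodule ℝ V5 := fun n => match n with
    | 0 => ⊤
    | 1 => p 0
    | 2 => p 0 ⊓ p 1 ⊓ p 3
    | _ => ⊥
  refine isSolvable_of_flag (L := Alg μ) S rfl ?_ (k := 3) rfl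
  intro n (x : V5) hx (y : V5) hy
  match n, hx, hy with
  | 0, hx, hy => exact h1 x y
  | 1, hx, hy => exact ⟨⟨h1 x y, (h2 x y hx hy).1⟩, (h2 x y hx hy).2⟩
  | 2, hx, hy => exact h3 x y hx.1.1 hx.1.2 hx.2 hy.1.1 hy.1.2 hy.2
  | n + 3, hx, hy =>
    have hx : x = 0 := hx
    subst hx
    exact LinearMap.map_zero₂ μ.1.1 y

theorem isSolvableLinearDeformation_nu1 : IsSolvableLinearDeformation g53 nu1 := by
  intro t
  have h : g53.1 + t • nu1 ∈ lieVariety V5 := by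
    refine add_smul_mem_lieVariety g53.2 (fun x y z => ?_) jacobiTerm_nu1 t
    ext m
    fin_cases m <;> simp [nu1, E_apply] <;> ring
  refine ⟨h, isSolvable_of_flag_V5 _ ?_ ?_ ?_⟩
  · intro x y
    simp [g53, nu1, E_apply]
  · intro x y h1 h2
    simp [g53, nu1, E_apply, h1, h2]
  · intro x y h1 h2 h3 h4 h5 h6
    simp [g53, nu1, E_apply, h1, h2, h3, h4, h5, h6]

theorem isSolvableLinearDeformation_nu2 : IsSolvableLinearDeformation g53 nu2 := by
  intro t
  have h : g53.1 + t • nu2 ∈ lieVariety V5 := by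
    refine add_smul_mem_lieVariety g53.2 (fun x y z => ?_) jacobiTerm_nu2 t
    ext m
    fin_cases m <;> simp [nu2, E_apply] <;> ring
  refine ⟨h, isSolvable_of_flag_V5 _ ?_ ?_ ?_⟩
  · intro x y
    simp [g53, nu2, E_apply]
  · intro x y h1 h2
    simp [g53, nu2, E_apply, h1, h2]
  · intro x y h1 h2 h3 h4 h5 h6
    simp [g53, nu2, E_apply, h1, h2, h3, h4, h5, h6]

end Deformations

end NilLie

namespace NilLie

/-! ### Nilpotent Lie algebras of dimension at most four -/

section LowDimension

universe u

/-- A nontrivial nilpotent algebra has a nonzero central element; the quotient is by the line it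
spans. This is the induction step of the classification. -/
theorem exists_central_quotient (L : Type u) [LieRing L] [LieAlgebra ℝ L] {n : ℕ}
    (hn : Module.finrank ℝ L = n + 1) [LieRing.IsNilpotent L] :
    ∃ (z : L) (Q : Type u) (_ : LieRing Q) (_ : LieAlgebra ℝ Q) (π : L →ₗ⁅ℝ⁆ Q),
      (∀ x : L, ⁅x, z⁆ = 0) ∧ Function.Surjective π ∧ (∀ x, π x = 0 → ∃ a : ℝ, x = a • z) ∧
        LieRing.IsNilpotent Q ∧ Module.finrank ℝ Q = n := by
  have : Nontrivial L := Module.nontrivial_of_finrank_pos (R := ℝ) (by omega)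
  have : FiniteDimensional ℝ L := Module.finite_of_finrank_pos (by omega)
  obtain ⟨⟨z, hz⟩, hz0⟩ := @exists_ne _ (LieModule.nontrivial_max_triv_of_isNilpotent ℝ L L) 0
  rw [LieModule.mem_maxTrivSubmodule] at hz
  have hz0 : z ≠ 0 := fun h => hz0 (Subtype.ext h)
  let I : LieIdeal ℝ L :=
    { Submodule.span ℝ {z} with
      lie_mem := by
        intro x m hm
        obtain ⟨a, rfl⟩ := Submodule.mem_span_singleton.1 hm
        rw [lie_smul, hz, smul_zero]
        exact Submodule.zero_mem _ }
  let π : L →ₗ⁅ℝ⁆ L ⧸ I :=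
    { (I.toSubmodule.mkQ : L →ₗ[ℝ] L ⧸ I) with map_lie' := rfl }
  have hπ : Function.Surjective π := Submodule.mkQ_surjective I.toSubmodule
  refine ⟨z, L ⧸ I, inferInstance, inferInstance, π, hz, hπ, ?_, hπ.lieAlgebra_isNilpotent, ?_⟩
  · intro x hx
    obtain ⟨a, ha⟩ := Submodule.mem_span_singleton.1
      ((Submodule.Quotient.mk_eq_zero (Submodule.span ℝ {z})).1 hx)
    exact ⟨a, ha.symm⟩
  · have h := Submodule.finrank_quotient_add_finrank (Submodule.span ℝ {z})
    rw [finrank_span_singleton hz0] at h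
    change Module.finrank ℝ (L ⧸ Submodule.span ℝ {z}) = n
    omega

theorem exists_generators_modulo {M : Type*} [AddCommGroup M] [Module ℝ M] (C : Submodule ℝ M)
    [FiniteDimensional ℝ C] {n : ℕ} (hC : Module.finrank ℝ C = n + 1) {w : M} (hw : w ∈ C)
    (hw0 : w ≠ 0) :
    ∃ y : Fin n → M, (∀ i, y i ∈ C) ∧
      ∀ v ∈ C, ∃ (a : ℝ) (c : Fin n → ℝ), v = a • w + ∑ i, c i • y i := by
  let w' : C := ⟨w, hw⟩
  have hw' : w' ≠ 0 := fun h => hw0 (congrArg Subtype.val h)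
  have h := Submodule.finrank_quotient_add_finrank (Submodule.span ℝ {w'})
  rw [finrank_span_singleton hw', hC] at h
  let b := Module.finBasisOfFinrankEq ℝ (C ⧸ Submodule.span ℝ {w'}) (n := n) (by omega)
  choose y hy using fun i => Submodule.mkQ_surjective (Submodule.span ℝ {w'}) (b i)
  refine ⟨fun i => y i, fun i => (y i).2, fun v hv => ?_⟩
  let v' : C := ⟨v, hv⟩
  let c := b.repr (Submodule.mkQ _ v')
  have h1 : Submodule.mkQ (Submodule.span ℝ {w'}) (v' - ∑ i, c i • y i) = 0 := by
    rw [map_sub, map_sum]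
    simp only [map_smul, hy]
    rw [b.sum_repr, sub_self]
  obtain ⟨a, ha⟩ := Submodule.mem_span_singleton.1 ((Submodule.Quotient.mk_eq_zero _).1 h1)
  refine ⟨a, c, ?_⟩
  have h2 := congrArg (Subtype.val : C → M) ha
  simp only [SetLike.val_smul, Submodule.coe_sub, Submodule.coe_sum] at h2
  change v = a • w + ∑ i, c i • (y i : M)
  rw [show a • w = v - ∑ i, c i • (y i : M) from h2, sub_add_cancel]

variable {L : Type u} [LieRing L] [LieAlgebra ℝ L]

/-- A nonabelian Lie algebra whose brackets lie in a central line is the sum of a hyperbolic pair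
and its centralizer. -/
theorem exists_hyperbolic_pair [FiniteDimensional ℝ L] {z : L} (hz : ∀ x : L, ⁅x, z⁆ = 0)
    (hL : ∀ x y : L, ∃ a : ℝ, ⁅x, y⁆ = a • z) (hne : ∃ x y : L, ⁅x, y⁆ ≠ 0) :
    ∃ (u v w : L) (C : Submodule ℝ L), ⁅u, v⁆ = w ∧ w ≠ 0 ∧ w ∈ C ∧ (∀ x : L, ⁅x, w⁆ = 0) ∧
      (∀ x y : L, ∃ a : ℝ, ⁅x, y⁆ = a • w) ∧ (∀ c ∈ C, ⁅u, c⁆ = 0 ∧ ⁅v, c⁆ = 0) ∧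
      (∀ x, ∃ a b : ℝ, ∃ c ∈ C, x = a • u + b • v + c) ∧
      Module.finrank ℝ C + 2 = Module.finrank ℝ L := by
  obtain ⟨u, v, huv⟩ := hne
  obtain ⟨s, hs⟩ := hL u v
  have hs0 : s ≠ 0 := by rintro rfl; exact huv (by rw [hs, zero_smul])
  set w := ⁅u, v⁆ with hw
  have hw' : ∀ x : L, ⁅x, w⁆ = 0 := fun x => by rw [hs, lie_smul, hz, smul_zero]
  have hL' : ∀ x y : L, ∃ a : ℝ, ⁅x, y⁆ = a • w := fun x y => by
    obtain ⟨a, ha⟩ := hL x y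
    refine ⟨a / s, ?_⟩
    rw [ha, hs, smul_smul, div_mul_cancel₀ _ hs0]
  -- Such a `ξ` turns the bracket into the scalar form `ξ ⁅x, y⁆`; the complement of the pair `u`,
  -- `v` is then its orthogonal, the kernel of `F`.
  obtain ⟨ξ, hξ⟩ : ∃ ξ : Module.Dual ℝ L, ξ w = 1 := by
    obtain ⟨ξ, hξ⟩ : ∃ ξ : Module.Dual ℝ L, ξ w ≠ 0 := by
      by_contra! h
      exact huv ((Module.forall_dual_apply_eq_zero_iff ℝ w).1 h)
    exact ⟨(ξ w)⁻¹ • ξ, by simp [hξ]⟩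
  have hmul : ∀ x y : L, ⁅x, y⁆ = ξ ⁅x, y⁆ • w := fun x y => by
    obtain ⟨a, ha⟩ := hL' x y
    rw [ha, map_smul, hξ, smul_eq_mul, mul_one]
  have hvu : ⁅v, u⁆ = -w := by rw [hw, lie_skew]
  let ad : L → L →ₗ[ℝ] L := fun x => LieAlgebra.ad ℝ L x
  let F : L →ₗ[ℝ] ℝ × ℝ := (ξ ∘ₗ ad u).prod (ξ ∘ₗ ad v)
  have hF : ∀ x, F x = (ξ ⁅u, x⁆, ξ ⁅v, x⁆) := fun x => rfl
  have hker : ∀ c ∈ LinearMap.ker F, ⁅u, c⁆ = 0 ∧ ⁅v, c⁆ = 0 := by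
    intro c hc
    have h : F c = 0 := hc
    rw [hF, Prod.mk_eq_zero] at h
    rw [hmul u c, hmul v c, h.1, h.2, zero_smul]
    exact ⟨rfl, rfl⟩
  have hrange : LinearMap.range F = ⊤ := by
    rw [LinearMap.range_eq_top]
    rintro ⟨a, b⟩
    refine ⟨a • v - b • u, ?_⟩
    rw [hF]
    simp [lie_sub, lie_smul, ← hw, hvu, hξ]
  refine ⟨u, v, w, LinearMap.ker F, rfl, huv, ?_, hw', hL', hker, ?_, ?_⟩
  · rw [LinearMap.mem_ker, hF, hw', hw', map_zero]
    rfl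
  · intro x
    -- The coefficients are forced: bracketing `a • u + b • v + c` with `u` gives `b • w`, and with
    -- `v` gives `-a • w`.
    refine ⟨-ξ ⁅v, x⁆, ξ ⁅u, x⁆, x - ξ ⁅u, x⁆ • v + ξ ⁅v, x⁆ • u, ?_, by module⟩
    rw [LinearMap.mem_ker, hF]
    simp [lie_sub, lie_add, lie_smul, ← hw, hvu, hξ]
  · have h := LinearMap.finrank_range_add_finrank_ker F
    rw [hrange, finrank_top, Module.finrank_prod, Module.finrank_self] at h
    omega

/-- The algebra is generated by a central element and one further vector. -/
theorem lie_eq_zero_of_finrank_two [LieRing.IsNilpotent L] (hL : Module.finrank ℝ L = 2)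
    (x y : L) : ⁅x, y⁆ = 0 := by
  obtain ⟨z, Q, _, _, π, hz, hπ, hker, -, hQ⟩ := exists_central_quotient L hL
  obtain ⟨q, -, hq⟩ := finrank_eq_one_iff'.1 hQ
  obtain ⟨t, rfl⟩ := hπ q
  have hgen : ∀ v, ∃ a b : ℝ, v = a • t + b • z := fun v => by
    obtain ⟨a, ha⟩ := hq (π v)
    obtain ⟨b, hb⟩ := hker (v - a • t) (by rw [map_sub, map_smul, ha, sub_self])
    exact ⟨a, b, by rw [← hb]; abel⟩
  have hz' : ∀ x : L, ⁅z, x⁆ = 0 := fun x => by rw [← lie_skew, hz, neg_zero]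
  obtain ⟨a, b, rfl⟩ := hgen x
  obtain ⟨c, d, rfl⟩ := hgen y
  simp [hz, hz']

theorem exists_generators_of_finrank_three [LieRing.IsNilpotent L]
    (hL : Module.finrank ℝ L = 3) (hne : ∃ x y : L, ⁅x, y⁆ ≠ 0) :
    ∃ x₁ x₂ x₃ : L, ⁅x₁, x₂⁆ = x₃ ∧ (∀ x : L, ⁅x, x₃⁆ = 0) ∧
      ∀ v, ∃ a b c : ℝ, v = a • x₁ + b • x₂ + c • x₃ := by
  have : FiniteDimensional ℝ L := Module.finite_of_finrank_pos (by omega)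
  obtain ⟨z, Q, _, _, π, hz, hπ, hker, _, hQ⟩ := exists_central_quotient L hL
  have hbr : ∀ x y : L, ∃ a : ℝ, ⁅x, y⁆ = a • z := fun x y =>
    hker _ (by rw [LieHom.map_lie, lie_eq_zero_of_finrank_two hQ])
  obtain ⟨u, v, w, C, huv, hw0, hwC, hw, -, -, hdec, hC⟩ := exists_hyperbolic_pair hz hbr hne
  obtain ⟨y, -, hy⟩ := exists_generators_modulo C (n := 0) (by omega) hwC hw0
  refine ⟨u, v, w, huv, hw, fun x => ?_⟩
  obtain ⟨a, b, c, hc, rfl⟩ := hdec x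
  obtain ⟨d, e, rfl⟩ := hy c hc
  exact ⟨a, b, d, by simp⟩

/-- The relations of the sum of a Heisenberg algebra and a line. -/
def IsHeisenbergLine (x₁ x₂ x₃ x₄ : L) : Prop :=
  ⁅x₁, x₂⁆ = x₃ ∧ ⁅x₁, x₃⁆ = 0 ∧ ⁅x₂, x₃⁆ = 0 ∧ ⁅x₁, x₄⁆ = 0 ∧ ⁅x₂, x₄⁆ = 0 ∧ ⁅x₃, x₄⁆ = 0 ∧
    ∀ v, ∃ a b c d : ℝ, v = a • x₁ + b • x₂ + c • x₃ + d • x₄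

/-- The relations of the filiform algebra of dimension four. -/
def IsFiliformFour (x₁ x₂ x₃ x₄ : L) : Prop :=
  ⁅x₁, x₂⁆ = x₃ ∧ ⁅x₁, x₃⁆ = x₄ ∧ ⁅x₂, x₃⁆ = 0 ∧ ⁅x₁, x₄⁆ = 0 ∧ ⁅x₂, x₄⁆ = 0 ∧ ⁅x₃, x₄⁆ = 0 ∧
    ∀ v, ∃ a b c d : ℝ, v = a • x₁ + b • x₂ + c • x₃ + d • x₄

theorem lie_eq_of_map_eq {Q : Type*} [LieRing Q] [LieAlgebra ℝ Q] {π : L →ₗ⁅ℝ⁆ Q} {z : L}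
    (hker : ∀ x, π x = 0 → ∃ a : ℝ, x = a • z) {x y : L} (h : ⁅π x, π y⁆ = 0) :
    ∃ a : ℝ, ⁅x, y⁆ = a • z :=
  hker _ (by rw [LieHom.map_lie, h])

theorem exists_generators_of_finrank_four [LieRing.IsNilpotent L]
    (hL : Module.finrank ℝ L = 4) (hne : ∃ x y : L, ⁅x, y⁆ ≠ 0) :
    ∃ x₁ x₂ x₃ x₄ : L, IsHeisenbergLine x₁ x₂ x₃ x₄ ∨ IsFiliformFour x₁ x₂ x₃ x₄ := by
  have : FiniteDimensional ℝ L := Module.finite_of_finrank_pos (by omega)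
  obtain ⟨z, Q, _, _, π, hz, hπ, hker, _, hQ⟩ := exists_central_quotient L hL
  by_cases hab : ∃ x y : Q, ⁅x, y⁆ ≠ 0
  · obtain ⟨q₁, q₂, q₃, h₁₂, h₃, hgen⟩ := exists_generators_of_finrank_three hQ hab
    obtain ⟨x₁, rfl⟩ := hπ q₁
    obtain ⟨x₂, rfl⟩ := hπ q₂
    rw [← LieHom.map_lie] at h₁₂
    subst h₁₂
    obtain ⟨α, hα⟩ := lie_eq_of_map_eq hker (h₃ (π x₁))
    obtain ⟨β, hβ⟩ := lie_eq_of_map_eq hker (h₃ (π x₂))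
    have hspan : ∀ v, ∃ a b c d : ℝ, v = a • x₁ + b • x₂ + c • ⁅x₁, x₂⁆ + d • z := fun v => by
      obtain ⟨a, b, c, h⟩ := hgen (π v)
      obtain ⟨d, hd⟩ := hker (v - (a • x₁ + b • x₂ + c • ⁅x₁, x₂⁆)) (by
        rw [map_sub, h]; simp)
      exact ⟨a, b, c, d, by rw [← hd]; abel⟩
    by_cases h0 : α = 0 ∧ β = 0
    · obtain ⟨rfl, rfl⟩ := h0
      rw [zero_smul] at hα hβ
      exact ⟨x₁, x₂, ⁅x₁, x₂⁆, z, Or.inl ⟨rfl, hα, hβ, hz _, hz _, hz _, hspan⟩⟩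
    · have hs : α ^ 2 + β ^ 2 ≠ 0 := fun h => h0 ⟨by nlinarith, by nlinarith⟩
      have h₂₁ : ⁅x₂, x₁⁆ = -⁅x₁, x₂⁆ := (lie_skew _ _).symm
      -- A rotation up to scale: the second new generator commutes with `⁅x₁, x₂⁆`. Its determinant
      -- `α ^ 2 + β ^ 2` is nonzero over `ℝ`, and powers of it scale the remaining vectors.
      refine ⟨α • x₁ + β • x₂, -β • x₁ + α • x₂, (α ^ 2 + β ^ 2) • ⁅x₁, x₂⁆,
        (α ^ 2 + β ^ 2) ^ 2 • z, Or.inr ⟨?_, ?_, ?_, ?_, ?_, ?_, fun v => ?_⟩⟩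
      · simp only [lie_add, add_lie, smul_lie, lie_smul, lie_self, h₂₁]
        module
      · simp only [add_lie, smul_lie, lie_smul, hα, hβ]
        module
      · simp only [add_lie, smul_lie, lie_smul, hα, hβ]
        module
      · rw [lie_smul, hz, smul_zero]
      · rw [lie_smul, hz, smul_zero]
      · rw [lie_smul, hz, smul_zero]
      · obtain ⟨a, b, c, d, rfl⟩ := hspan v
        refine ⟨(a * α + b * β) / (α ^ 2 + β ^ 2), (b * α - a * β) / (α ^ 2 + β ^ 2),
          c / (α ^ 2 + β ^ 2), d / (α ^ 2 + β ^ 2) ^ 2, ?_⟩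
        match_scalars <;> field_simp <;> ring
  · push Not at hab
    have hbr : ∀ x y : L, ∃ a : ℝ, ⁅x, y⁆ = a • z := fun x y => lie_eq_of_map_eq hker (hab _ _)
    obtain ⟨u, v, w, C, huv, hw0, hwC, hw, -, hcen, hdec, hC⟩ := exists_hyperbolic_pair hz hbr hne
    obtain ⟨y, hyC, hy⟩ := exists_generators_modulo C (n := 1) (by omega) hwC hw0
    have hw' : ⁅w, y 0⁆ = 0 := by rw [← lie_skew, hw, neg_zero]
    refine ⟨u, v, w, y 0, Or.inl ⟨huv, hw _, hw _, (hcen _ (hyC 0)).1, (hcen _ (hyC 0)).2, hw',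
      fun x => ?_⟩⟩
    obtain ⟨a, b, c, hc, rfl⟩ := hdec x
    obtain ⟨d, e, rfl⟩ := hy c hc
    exact ⟨a, b, d, e 0, by simp [add_assoc]⟩

end LowDimension

end NilLie

namespace NilLie

/-! ### Nilpotent Lie algebras of dimension five -/

section Classification

universe u

variable {L : Type u} [LieRing L] [LieAlgebra ℝ L]

/-- Five generators of a 5-dimensional space form a basis, and by antisymmetry the brackets with `i
< j` determine the structure. It thus suffices to exhibit generators with the right relations. -/
theorem nonempty_lieEquiv (hL : Module.finrank ℝ L = 5) (μ : lieVariety V5) (x : Fin 5 → L)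
    (hx : ∀ v, ∃ c : Fin 5 → ℝ, v = ∑ i, c i • x i)
    (hbr : ∀ i j, i < j →
      ⁅x i, x j⁆ = ∑ l, μ.1.1 (Pi.single i 1) (Pi.single j 1) l • x l) :
    Nonempty (L ≃ₗ⁅ℝ⁆ Alg μ) := by
  have hspan : ⊤ ≤ Submodule.span ℝ (Set.range x) := by
    intro v _
    obtain ⟨c, rfl⟩ := hx v
    exact Submodule.sum_mem _ fun i _ =>
      Submodule.smul_mem _ _ (Submodule.subset_span ⟨i, rfl⟩)
  let b := basisOfTopLeSpanOfCardEqFinrank x hspan (by rw [hL]; rfl)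
  have hb : ⇑b = x := coe_basisOfTopLeSpanOfCardEqFinrank x hspan _
  let e : L ≃ₗ[ℝ] V5 := b.equivFun
  have he : ∀ i, e (x i) = Pi.single i 1 := fun i => by
    rw [← hb]
    ext j
    simp [e, b.equivFun_self, Pi.single_apply, eq_comm]
  let A : L →ₗ[ℝ] L →ₗ[ℝ] V5 := (LieAlgebra.ad ℝ L : L →ₗ[ℝ] Module.End ℝ L).compr₂ e
  let B : L →ₗ[ℝ] L →ₗ[ℝ] V5 := μ.1.1.compl₁₂ (e : L →ₗ[ℝ] V5) (e : L →ₗ[ℝ] V5)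
  have hA : ∀ u v, A u v = e ⁅u, v⁆ := fun _ _ => rfl
  have hB : ∀ u v, B u v = μ.1.1 (e u) (e v) := fun _ _ => rfl
  have hlt : ∀ i j, i < j → A (x i) (x j) = B (x i) (x j) := by
    intro i j hij
    rw [hA, hB, hbr i j hij, he, he, map_sum]
    simp only [map_smul, he]
    ext l
    simp [Finset.sum_apply, Pi.single_apply]
  have hAB : A = B := by
    refine b.ext fun i => b.ext fun j => ?_
    rw [hb]
    rcases lt_trichotomy i j with hij | rfl | hij
    · exact hlt i j hij
    · rw [hA, hB, lie_self, map_zero, μ.1.2]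
    · rw [hA, ← lie_skew, map_neg, ← hA, hlt j i hij, hB, hB, AltBracket.skew μ.1 (e (x i))]
  exact ⟨{ e with
    map_lie' := fun {u v} => LinearMap.congr_fun (LinearMap.congr_fun hAB u) v }⟩

/-- The vectors `x₁, …, x₅` generate `L`. -/
def Generates (x₁ x₂ x₃ x₄ x₅ : L) : Prop :=
  ∀ v, ∃ a b c d e : ℝ, v = a • x₁ + b • x₂ + c • x₃ + d • x₄ + e • x₅

/-- The brackets of `x₁, …, x₅`, in the lexicographic order of pairs, are the entries of `y`. -/
def HasBrackets (x₁ x₂ x₃ x₄ x₅ : L) (y : Fin 10 → L) : Prop :=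
  ⁅x₁, x₂⁆ = y 0 ∧ ⁅x₁, x₃⁆ = y 1 ∧ ⁅x₁, x₄⁆ = y 2 ∧ ⁅x₁, x₅⁆ = y 3 ∧ ⁅x₂, x₃⁆ = y 4 ∧
    ⁅x₂, x₄⁆ = y 5 ∧ ⁅x₂, x₅⁆ = y 6 ∧ ⁅x₃, x₄⁆ = y 7 ∧ ⁅x₃, x₅⁆ = y 8 ∧ ⁅x₄, x₅⁆ = y 9

theorem nonempty_lieEquiv_of_hasBrackets (hL : Module.finrank ℝ L = 5) (μ : lieVariety V5)
    {x₁ x₂ x₃ x₄ x₅ : L} (hx : Generates x₁ x₂ x₃ x₄ x₅) {y : Fin 10 → L}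
    (hy : HasBrackets x₁ x₂ x₃ x₄ x₅ y)
    (hμ : ∀ p : Fin 10, y p = ∑ l, μ.1.1 (Pi.single (pairOf p).1 1) (Pi.single (pairOf p).2 1) l •
      ![x₁, x₂, x₃, x₄, x₅] l) : Nonempty (L ≃ₗ⁅ℝ⁆ Alg μ) := by
  refine nonempty_lieEquiv hL μ ![x₁, x₂, x₃, x₄, x₅] (fun v => ?_) fun i j hij => ?_
  · obtain ⟨a, b, c, d, e, rfl⟩ := hx v
    exact ⟨![a, b, c, d, e], by simp [Fin.sum_univ_five]⟩
  · obtain ⟨p, hp, -⟩ := exists_pairOf i j hij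
    have h := hμ p
    rw [hp] at h
    rw [← h]
    obtain ⟨h0, h1, h2, h3, h4, h5, h6, h7, h8, h9⟩ := hy
    clear h hμ hx
    fin_cases p <;> (simp [pairOf] at hp; obtain ⟨rfl, rfl⟩ := hp; assumption)

theorem nonempty_lieEquiv_f3R2 (hL : Module.finrank ℝ L = 5) {a b c d e : L}
    (hx : Generates a b c d e) (hy : HasBrackets a b c d e ![c, 0, 0, 0, 0, 0, 0, 0, 0, 0]) :
    Nonempty (L ≃ₗ⁅ℝ⁆ Alg f3R2) :=
  nonempty_lieEquiv_of_hasBrackets hL f3R2 hx hy fun p => by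
    fin_cases p <;> simp [pairOf, f3R2, E_apply]

theorem nonempty_lieEquiv_g51 (hL : Module.finrank ℝ L = 5) {a b c d e : L}
    (hx : Generates a b c d e) (hy : HasBrackets a b c d e ![e, 0, 0, 0, 0, 0, 0, e, 0, 0]) :
    Nonempty (L ≃ₗ⁅ℝ⁆ Alg g51) :=
  nonempty_lieEquiv_of_hasBrackets hL g51 hx hy fun p => by
    fin_cases p <;> simp [pairOf, g51, E_apply]

theorem nonempty_lieEquiv_g52 (hL : Module.finrank ℝ L = 5) {a b c d e : L}
    (hx : Generates a b c d e) (hy : HasBrackets a b c d e ![d, e, 0, 0, 0, 0, 0, 0, 0, 0]) :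
    Nonempty (L ≃ₗ⁅ℝ⁆ Alg g52) :=
  nonempty_lieEquiv_of_hasBrackets hL g52 hx hy fun p => by
    fin_cases p <;> simp [pairOf, g52, E_apply]

theorem nonempty_lieEquiv_f4R (hL : Module.finrank ℝ L = 5) {a b c d e : L}
    (hx : Generates a b c d e) (hy : HasBrackets a b c d e ![c, d, 0, 0, 0, 0, 0, 0, 0, 0]) :
    Nonempty (L ≃ₗ⁅ℝ⁆ Alg f4R) :=
  nonempty_lieEquiv_of_hasBrackets hL f4R hx hy fun p => by
    fin_cases p <;> simp [pairOf, f4R, E_apply]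

theorem nonempty_lieEquiv_g53 (hL : Module.finrank ℝ L = 5) {a b c d e : L}
    (hx : Generates a b c d e) (hy : HasBrackets a b c d e ![d, 0, e, 0, e, 0, 0, 0, 0, 0]) :
    Nonempty (L ≃ₗ⁅ℝ⁆ Alg g53) :=
  nonempty_lieEquiv_of_hasBrackets hL g53 hx hy fun p => by
    fin_cases p <;> simp [pairOf, g53, E_apply]

theorem nonempty_lieEquiv_g54 (hL : Module.finrank ℝ L = 5) {a b c d e : L}
    (hx : Generates a b c d e) (hy : HasBrackets a b c d e ![c, d, 0, 0, e, 0, 0, 0, 0, 0]) :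
    Nonempty (L ≃ₗ⁅ℝ⁆ Alg g54) :=
  nonempty_lieEquiv_of_hasBrackets hL g54 hx hy fun p => by
    fin_cases p <;> simp [pairOf, g54, E_apply]

theorem nonempty_lieEquiv_f5 (hL : Module.finrank ℝ L = 5) {a b c d e : L}
    (hx : Generates a b c d e) (hy : HasBrackets a b c d e ![c, d, e, 0, 0, 0, 0, 0, 0, 0]) :
    Nonempty (L ≃ₗ⁅ℝ⁆ Alg f5) :=
  nonempty_lieEquiv_of_hasBrackets hL f5 hx hy fun p => by
    fin_cases p <;> simp [pairOf, f5, E_apply]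

theorem nonempty_lieEquiv_g56 (hL : Module.finrank ℝ L = 5) {a b c d e : L}
    (hx : Generates a b c d e) (hy : HasBrackets a b c d e ![c, d, e, 0, e, 0, 0, 0, 0, 0]) :
    Nonempty (L ≃ₗ⁅ℝ⁆ Alg g56) :=
  nonempty_lieEquiv_of_hasBrackets hL g56 hx hy fun p => by
    fin_cases p <;> simp [pairOf, g56, E_apply]

variable (L) in
/-- `L` is isomorphic to one of the algebras of the table. -/
def IsInTable : Prop := ∃ i : Fin 8, Nonempty (L ≃ₗ⁅ℝ⁆ Alg (table i))

end Classification

end NilLie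

namespace NilLie

/-! ### Normal forms of the central extensions. -/

section Classification

universe u

variable {L : Type u} [LieRing L] [LieAlgebra ℝ L]

/-- The bracket is a scalar alternating form with values in a line. After splitting off one
hyperbolic pair, the two remaining generators either commute (rank two, `f3R2`) or form a second
pair (rank four, `g51`). -/
theorem isInTable_of_lie_mem_line (hL : Module.finrank ℝ L = 5) {z : L}
    (hz : ∀ x : L, ⁅x, z⁆ = 0) (hbr : ∀ x y : L, ∃ a : ℝ, ⁅x, y⁆ = a • z)
    (hne : ∃ x y : L, ⁅x, y⁆ ≠ 0) : IsInTable L := by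
  have : FiniteDimensional ℝ L := Module.finite_of_finrank_pos (by omega)
  obtain ⟨u, v, w, C, huv, hw0, hwC, hw, hbr', hcen, hdec, hC⟩ :=
    exists_hyperbolic_pair hz hbr hne
  obtain ⟨y, hyC, hy⟩ := exists_generators_modulo C (n := 2) (by omega) hwC hw0
  have hw' : ∀ x : L, ⁅w, x⁆ = 0 := fun x => by rw [← lie_skew, hw, neg_zero]
  obtain ⟨hu0, hv0⟩ := hcen _ (hyC 0)
  obtain ⟨hu1, hv1⟩ := hcen _ (hyC 1)
  have hgen : ∀ x, ∃ a b c d e : ℝ, x = a • u + b • v + c • w + d • y 0 + e • y 1 := by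
    intro x
    obtain ⟨a, b, c, hc, rfl⟩ := hdec x
    obtain ⟨d, e, rfl⟩ := hy c hc
    exact ⟨a, b, d, e 0, e 1, by simp [Fin.sum_univ_two]; abel⟩
  obtain ⟨ε, hε⟩ := hbr' (y 0) (y 1)
  by_cases h0 : ε = 0
  · rw [h0, zero_smul] at hε
    exact ⟨0, nonempty_lieEquiv_f3R2 hL (a := u) (b := v) (c := w) (d := y 0) (e := y 1) hgen
      ⟨huv, hw _, hu0, hu1, hw _, hv0, hv1, hw' _, hw' _, hε⟩⟩
  · refine ⟨1, nonempty_lieEquiv_g51 hL (a := u) (b := v) (c := y 0) (d := ε⁻¹ • y 1) (e := w)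
      (fun x => ?_) ⟨huv, hu0, ?_, hw _, hv0, ?_, hw _, ?_, hw _, hw _⟩⟩
    · obtain ⟨a, b, c, d, e, rfl⟩ := hgen x
      refine ⟨a, b, d, e * ε, c, ?_⟩
      match_scalars <;> field_simp
    · rw [lie_smul, hu1, smul_zero]; rfl
    · rw [lie_smul, hv1, smul_zero]; rfl
    · rw [lie_smul, hε, inv_smul_smul₀ h0]; rfl

theorem isInTable_of_threeStep (hL : Module.finrank ℝ L = 5) {x₁ x₂ x₃ x₄ z : L} {γ δ : ℝ}
    (hz : ∀ x : L, ⁅x, z⁆ = 0) (hgen : Generates x₁ x₂ x₃ x₄ z) (h₁₂ : ⁅x₁, x₂⁆ = x₃)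
    (h₁₃ : ⁅x₁, x₃⁆ = z) (h₂₃ : ⁅x₂, x₃⁆ = 0) (h₁₄ : ⁅x₁, x₄⁆ = γ • z) (h₂₄ : ⁅x₂, x₄⁆ = δ • z)
    (h₃₄ : ⁅x₃, x₄⁆ = 0) : IsInTable L := by
  have hz' : ∀ x : L, ⁅z, x⁆ = 0 := fun x => by rw [← lie_skew, hz, neg_zero]
  -- As `⁅x₁, x₃⁆ = z`, this correction makes the fourth generator commute with `x₁`, and only `δ`
  -- remains to be discussed.
  set y := x₄ - γ • x₃ with hy
  have hgen' : Generates x₁ x₂ x₃ y z := fun x => by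
    obtain ⟨a, b, c, d, e, rfl⟩ := hgen x
    exact ⟨a, b, c + d * γ, d, e, by rw [hy]; module⟩
  have h₁ : ⁅x₁, y⁆ = 0 := by rw [hy, lie_sub, lie_smul, h₁₃, h₁₄, sub_self]
  have h₂ : ⁅x₂, y⁆ = δ • z := by rw [hy, lie_sub, lie_smul, h₂₃, h₂₄, smul_zero, sub_zero]
  have h₃ : ⁅x₃, y⁆ = 0 := by rw [hy, lie_sub, lie_smul, h₃₄, lie_self, smul_zero, sub_zero]
  clear_value y
  by_cases h0 : δ = 0
  · rw [h0, zero_smul] at h₂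
    refine ⟨3, nonempty_lieEquiv_f4R hL (a := x₁) (b := x₂) (c := x₃) (d := z) (e := y)
      (fun x => ?_) ⟨h₁₂, h₁₃, hz _, h₁, h₂₃, hz _, h₂, hz _, h₃, hz' _⟩⟩
    obtain ⟨a, b, c, d, e, rfl⟩ := hgen' x
    exact ⟨a, b, c, e, d, by abel⟩
  · refine ⟨4, nonempty_lieEquiv_g53 hL (a := x₁) (b := x₂) (c := δ⁻¹ • y) (d := x₃) (e := z)
      (fun x => ?_) ⟨h₁₂, ?_, h₁₃, hz _, ?_, h₂₃, hz _, ?_, hz _, hz _⟩⟩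
    · obtain ⟨a, b, c, d, e, rfl⟩ := hgen' x
      refine ⟨a, b, d * δ, c, e, ?_⟩
      match_scalars <;> field_simp
    · rw [lie_smul, h₁, smul_zero]; rfl
    · rw [lie_smul, h₂, inv_smul_smul₀ h0]; rfl
    · rw [smul_lie, ← lie_skew, h₃, neg_zero, smul_zero]; rfl

theorem isInTable_of_twoStep (hL : Module.finrank ℝ L = 5) {x₁ x₂ x₃ x₄ z : L} {γ δ : ℝ}
    (hz : ∀ x : L, ⁅x, z⁆ = 0) (hgen : Generates x₁ x₂ x₃ x₄ z) (h₁₂ : ⁅x₁, x₂⁆ = x₃)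
    (h₁₃ : ⁅x₁, x₃⁆ = 0) (h₂₃ : ⁅x₂, x₃⁆ = 0) (h₁₄ : ⁅x₁, x₄⁆ = γ • z) (h₂₄ : ⁅x₂, x₄⁆ = δ • z)
    (h₃₄ : ⁅x₃, x₄⁆ = 0) : IsInTable L := by
  by_cases h0 : γ = 0 ∧ δ = 0
  · rw [h0.1, zero_smul] at h₁₄
    rw [h0.2, zero_smul] at h₂₄
    exact ⟨0, nonempty_lieEquiv_f3R2 hL hgen
      ⟨h₁₂, h₁₃, h₁₄, hz _, h₂₃, h₂₄, hz _, h₃₄, hz _, hz _⟩⟩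
  · have hs : γ ^ 2 + δ ^ 2 ≠ 0 := fun h => h0 ⟨by nlinarith, by nlinarith⟩
    have h₂₁ : ⁅x₂, x₁⁆ = -x₃ := by rw [← h₁₂, lie_skew]
    have h₄₃ : ⁅x₄, x₃⁆ = 0 := by rw [← lie_skew, h₃₄, neg_zero]
    have hze : ∀ x : L, ⁅x, (γ ^ 2 + δ ^ 2) • z⁆ = 0 := fun x => by rw [lie_smul, hz, smul_zero]
    -- The rotation of `x₁, x₂` makes the second generator commute with `x₄`, since `-δ * γ + γ * δ
    -- = 0`.
    refine ⟨2, nonempty_lieEquiv_g52 hL (a := γ • x₁ + δ • x₂) (b := -δ • x₁ + γ • x₂) (c := x₄)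
      (d := (γ ^ 2 + δ ^ 2) • x₃) (e := (γ ^ 2 + δ ^ 2) • z) (fun x => ?_)
      ⟨?_, ?_, ?_, hze _, ?_, ?_, hze _, ?_, hze _, hze _⟩⟩
    · obtain ⟨a, b, c, d, e, rfl⟩ := hgen x
      refine ⟨(a * γ + b * δ) / (γ ^ 2 + δ ^ 2), (b * γ - a * δ) / (γ ^ 2 + δ ^ 2), d,
        c / (γ ^ 2 + δ ^ 2), e / (γ ^ 2 + δ ^ 2), ?_⟩
      match_scalars <;> field_simp <;> ring
    · simp only [lie_add, add_lie, smul_lie, lie_smul, lie_self, h₁₂, h₂₁, Matrix.cons_val_zero]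
      module
    · simp only [add_lie, smul_lie, h₁₄, h₂₄, Matrix.cons_val_one, Matrix.cons_val_zero]
      module
    · simp [h₁₃, h₂₃]
    · simp only [add_lie, smul_lie, h₁₄, h₂₄, Matrix.cons_val]
      module
    · simp [h₁₃, h₂₃]
    · simp [h₄₃]

/-- The lifts satisfy `⁅x₁, x₃⁆ = α • z` and `⁅x₂, x₃⁆ = β • z` with `x₃ = ⁅x₁, x₂⁆`. The extension
is two-step if `α = β = 0`; otherwise a rotation of `x₁, x₂` reduces it to `α = 1`, `β = 0`. -/
theorem isInTable_of_heisenbergLine (hL : Module.finrank ℝ L = 5) {Q : Type*} [LieRing Q]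
    [LieAlgebra ℝ Q] {π : L →ₗ⁅ℝ⁆ Q} {z : L} (hz : ∀ x : L, ⁅x, z⁆ = 0)
    (hπ : Function.Surjective π) (hker : ∀ x, π x = 0 → ∃ a : ℝ, x = a • z) {q₁ q₂ q₃ q₄ : Q}
    (hq : IsHeisenbergLine q₁ q₂ q₃ q₄) : IsInTable L := by
  obtain ⟨x₁, rfl⟩ := hπ q₁
  obtain ⟨x₂, rfl⟩ := hπ q₂
  obtain ⟨x₄, rfl⟩ := hπ q₄
  obtain ⟨h₁₂, h₁₃, h₂₃, h₁₄, h₂₄, h₃₄, hgen⟩ := hq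
  rw [← LieHom.map_lie] at h₁₂
  subst h₁₂
  obtain ⟨α, hα⟩ := lie_eq_of_map_eq hker h₁₃
  obtain ⟨β, hβ⟩ := lie_eq_of_map_eq hker h₂₃
  obtain ⟨γ, hγ⟩ := lie_eq_of_map_eq hker h₁₄
  obtain ⟨δ, hδ⟩ := lie_eq_of_map_eq hker h₂₄
  -- Jacobi identity: `x₄` brackets `x₁` and `x₂` into the centre.
  have h34 : ⁅⁅x₁, x₂⁆, x₄⁆ = 0 := by
    rw [lie_lie, hγ, hδ, lie_smul, lie_smul, hz, hz, smul_zero, smul_zero, sub_zero]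
  have hgen' : Generates x₁ x₂ ⁅x₁, x₂⁆ x₄ z := fun v => by
    obtain ⟨a, b, c, d, h⟩ := hgen (π v)
    obtain ⟨e, he⟩ := hker (v - (a • x₁ + b • x₂ + c • ⁅x₁, x₂⁆ + d • x₄)) (by
      rw [map_sub, h]; simp)
    exact ⟨a, b, c, d, e, by rw [← he]; abel⟩
  by_cases h0 : α = 0 ∧ β = 0
  · rw [h0.1, zero_smul] at hα
    rw [h0.2, zero_smul] at hβ
    exact isInTable_of_twoStep hL hz hgen' rfl hα hβ hγ hδ h34
  · have hs : α ^ 2 + β ^ 2 ≠ 0 := fun h => h0 ⟨by nlinarith, by nlinarith⟩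
    have h₂₁ : ⁅x₂, x₁⁆ = -⁅x₁, x₂⁆ := (lie_skew _ _).symm
    refine isInTable_of_threeStep hL (x₁ := α • x₁ + β • x₂) (x₂ := -β • x₁ + α • x₂)
      (x₃ := (α ^ 2 + β ^ 2) • ⁅x₁, x₂⁆) (x₄ := x₄) (z := (α ^ 2 + β ^ 2) ^ 2 • z)
      -- These are the coefficients of the brackets of the rotated generators with `x₄`, relative to
      -- the rescaled central vector.
      (γ := (α * γ + β * δ) / (α ^ 2 + β ^ 2) ^ 2) (δ := (α * δ - β * γ) / (α ^ 2 + β ^ 2) ^ 2)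
      (fun x => ?_) (fun x => ?_) ?_ ?_ ?_ ?_ ?_ ?_
    · rw [lie_smul, hz, smul_zero]
    · obtain ⟨a, b, c, d, e, rfl⟩ := hgen' x
      refine ⟨(a * α + b * β) / (α ^ 2 + β ^ 2), (b * α - a * β) / (α ^ 2 + β ^ 2),
        c / (α ^ 2 + β ^ 2), d, e / (α ^ 2 + β ^ 2) ^ 2, ?_⟩
      match_scalars <;> field_simp <;> ring
    · simp only [lie_add, add_lie, smul_lie, lie_smul, lie_self, h₂₁]
      module
    · simp only [add_lie, smul_lie, lie_smul, hα, hβ]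
      module
    · simp only [add_lie, smul_lie, lie_smul, hα, hβ]
      module
    · simp only [add_lie, smul_lie, hγ, hδ]
      match_scalars
      field_simp
    · simp only [add_lie, smul_lie, hγ, hδ]
      match_scalars
      field_simp
      ring
    · rw [smul_lie, h34, smul_zero]

/-- The Jacobi identity gives `⁅x₂, x₄⁆ = ⁅x₃, x₄⁆ = 0`, which leaves `⁅x₁, x₄⁆ = α • z` and `⁅x₂,
x₃⁆ = β • z`. The four cases of vanishing of `α` and `β` give `f4R`, `g54`, `f5` and `g56`. -/
theorem isInTable_of_filiformFour (hL : Module.finrank ℝ L = 5) {Q : Type*} [LieRing Q]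
    [LieAlgebra ℝ Q] {π : L →ₗ⁅ℝ⁆ Q} {z : L} (hz : ∀ x : L, ⁅x, z⁆ = 0)
    (hπ : Function.Surjective π) (hker : ∀ x, π x = 0 → ∃ a : ℝ, x = a • z) {q₁ q₂ q₃ q₄ : Q}
    (hq : IsFiliformFour q₁ q₂ q₃ q₄) : IsInTable L := by
  obtain ⟨x₁, rfl⟩ := hπ q₁
  obtain ⟨x₂, rfl⟩ := hπ q₂
  obtain ⟨h₁₂, h₁₃, h₂₃, h₁₄, h₂₄, h₃₄, hgen⟩ := hq
  rw [← LieHom.map_lie] at h₁₂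
  subst h₁₂
  rw [← LieHom.map_lie] at h₁₃
  subst h₁₃
  obtain ⟨α, hα⟩ := lie_eq_of_map_eq hker h₁₄
  obtain ⟨β, hβ⟩ := lie_eq_of_map_eq hker h₂₃
  set x₃ := ⁅x₁, x₂⁆ with h12
  set x₄ := ⁅x₁, x₃⁆ with h13
  have h24 : ⁅x₂, x₄⁆ = 0 := by
    rw [h13, leibniz_lie, hβ, lie_smul, hz, smul_zero, add_zero, ← lie_skew x₂ x₁, ← h12, neg_lie,
      lie_self, neg_zero]
  have h34 : ⁅x₃, x₄⁆ = 0 := by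
    rw [h12, lie_lie, h24, hα, lie_smul, hz, lie_zero, smul_zero, sub_zero]
  have hgen' : Generates x₁ x₂ x₃ x₄ z := fun v => by
    obtain ⟨a, b, c, d, h⟩ := hgen (π v)
    obtain ⟨e, he⟩ := hker (v - (a • x₁ + b • x₂ + c • x₃ + d • x₄)) (by
      rw [map_sub, h]; simp)
    exact ⟨a, b, c, d, e, by rw [← he]; abel⟩
  have hze : ∀ (a : ℝ) (x : L), ⁅x, a • z⁆ = 0 := fun a x => by rw [lie_smul, hz, smul_zero]
  by_cases hα0 : α = 0
  · rw [hα0, zero_smul] at hα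
    by_cases hβ0 : β = 0
    · rw [hβ0, zero_smul] at hβ
      exact ⟨3, nonempty_lieEquiv_f4R hL hgen'
        ⟨rfl, rfl, hα, hz _, hβ, h24, hz _, h34, hz _, hz _⟩⟩
    · refine ⟨5, nonempty_lieEquiv_g54 hL (a := x₁) (b := x₂) (c := x₃) (d := x₄) (e := β • z)
        (fun x => ?_) ⟨rfl, rfl, hα, hze _ _, hβ, h24, hze _ _, h34, hze _ _, hze _ _⟩⟩
      obtain ⟨a, b, c, d, e, rfl⟩ := hgen' x
      refine ⟨a, b, c, d, e / β, ?_⟩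
      match_scalars <;> field_simp
  · by_cases hβ0 : β = 0
    · rw [hβ0, zero_smul] at hβ
      refine ⟨6, nonempty_lieEquiv_f5 hL (a := x₁) (b := x₂) (c := x₃) (d := x₄) (e := α • z)
        (fun x => ?_) ⟨rfl, rfl, hα, hze _ _, hβ, h24, hze _ _, h34, hze _ _, hze _ _⟩⟩
      obtain ⟨a, b, c, d, e, rfl⟩ := hgen' x
      refine ⟨a, b, c, d, e / α, ?_⟩
      match_scalars <;> field_simp
    -- Scaling `x₂, x₃, x₄` by `r` gives the two central brackets the coefficients `r * α` and `r ^
    -- 2 * β`; they agree for `r = α / β`.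
    · refine ⟨7, nonempty_lieEquiv_g56 hL (a := x₁) (b := (α / β) • x₂) (c := (α / β) • x₃)
        (d := (α / β) • x₄) (e := (α / β * α) • z) (fun x => ?_)
        ⟨?_, ?_, ?_, hze _ _, ?_, ?_, hze _ _, ?_, hze _ _, hze _ _⟩⟩
      · obtain ⟨a, b, c, d, e, rfl⟩ := hgen' x
        refine ⟨a, b * β / α, c * β / α, d * β / α, e * β / α ^ 2, ?_⟩
        match_scalars <;> field_simp
      · rw [lie_smul]; rfl
      · rw [lie_smul]; rfl
      · rw [lie_smul, hα, smul_smul]; rfl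
      · rw [lie_smul, smul_lie, hβ, smul_smul, smul_smul]
        change _ = (α / β * α) • z
        congr 1
        field_simp
      · rw [lie_smul, smul_lie, h24, smul_zero, smul_zero]; rfl
      · rw [lie_smul, smul_lie, h34, smul_zero, smul_zero]; rfl

theorem isInTable_of_finrank_five [LieRing.IsNilpotent L] (hL : Module.finrank ℝ L = 5)
    (hne : ∃ x y : L, ⁅x, y⁆ ≠ 0) : IsInTable L := by
  obtain ⟨z, Q, _, _, π, hz, hπ, hker, _, hQ⟩ := exists_central_quotient L hL
  by_cases hab : ∃ x y : Q, ⁅x, y⁆ ≠ 0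
  · obtain ⟨q₁, q₂, q₃, q₄, h | h⟩ := exists_generators_of_finrank_four hQ hab
    · exact isInTable_of_heisenbergLine hL hz hπ hker h
    · exact isInTable_of_filiformFour hL hz hπ hker h
  · push Not at hab
    exact isInTable_of_lie_mem_line hL hz (fun x y => lie_eq_of_map_eq hker (hab _ _)) hne

end Classification

end NilLie

namespace NilLie

open LieModule.Cohomology

/-! ### Invariants -/

section Invariants

variable {L L' : Type*} [LieRing L] [LieAlgebra ℝ L] [LieRing L'] [LieAlgebra ℝ L']

theorem d₁₂_conj_eq_zero (e : L ≃ₗ⁅ℝ⁆ L') {f : L →ₗ[ℝ] L} (h : d₁₂ ℝ L L f = 0) :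
    d₁₂ ℝ L' L' (e.toLinearEquiv.arrowCongr e.toLinearEquiv f) = 0 := by
  refine Subtype.ext (LinearMap.ext fun x => LinearMap.ext fun y => ?_)
  have h1 : ⁅e.symm x, f (e.symm y)⁆ - ⁅e.symm y, f (e.symm x)⁆ - f ⁅e.symm x, e.symm y⁆ = 0 :=
    congrArg (fun σ : twoCochain ℝ L L => σ.1 (e.symm x) (e.symm y)) h
  change ⁅x, e (f (e.symm y))⁆ - ⁅y, e (f (e.symm x))⁆ - e (f (e.symm ⁅x, y⁆)) = 0
  have h2 := congrArg e h1
  rw [map_zero, map_sub, map_sub, LieEquiv.map_lie, LieEquiv.map_lie, e.apply_symm_apply,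
    e.apply_symm_apply] at h2
  rwa [LieEquiv.map_lie]

/-- An isomorphism conjugates derivations into derivations, and the coboundary dimension is that of
`End L` minus that of the derivations. -/
theorem finrank_coboundary_eq [FiniteDimensional ℝ L] [FiniteDimensional ℝ L']
    (e : L ≃ₗ⁅ℝ⁆ L') :
    Module.finrank ℝ (coboundary L) = Module.finrank ℝ (coboundary L') := by
  let c : (L →ₗ[ℝ] L) ≃ₗ[ℝ] (L' →ₗ[ℝ] L') := e.toLinearEquiv.arrowCongr e.toLinearEquiv
  let d : (L →ₗ[ℝ] L) →ₗ[ℝ] twoCochain ℝ L L := d₁₂ ℝ L L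
  let d' : (L' →ₗ[ℝ] L') →ₗ[ℝ] twoCochain ℝ L' L' := d₁₂ ℝ L' L'
  have hker : (LinearMap.ker d).map (c : (L →ₗ[ℝ] L) →ₗ[ℝ] (L' →ₗ[ℝ] L')) = LinearMap.ker d' := by
    ext f
    rw [Submodule.mem_map_equiv, LinearMap.mem_ker, LinearMap.mem_ker]
    constructor
    · intro h
      have := d₁₂_conj_eq_zero e h
      rwa [show e.toLinearEquiv.arrowCongr e.toLinearEquiv (c.symm f) = f from
        c.apply_symm_apply f] at this
    · intro h
      exact d₁₂_conj_eq_zero e.symm h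
  have h1 := LinearMap.finrank_range_add_finrank_ker d
  have h2 := LinearMap.finrank_range_add_finrank_ker d'
  have h3 := LinearEquiv.finrank_map_eq c (LinearMap.ker d)
  have h4 := LinearEquiv.finrank_eq c
  rw [hker] at h3
  change Module.finrank ℝ (LinearMap.range d) = Module.finrank ℝ (LinearMap.range d')
  omega

/-- The Pfaffian of the alternating form `ξ ∘ ⁅·,·⁆` on the vectors `x`. -/
def pfaffian (ξ : Module.Dual ℝ L) (x : Fin 4 → L) : ℝ :=
  ξ ⁅x 0, x 1⁆ * ξ ⁅x 2, x 3⁆ - ξ ⁅x 0, x 2⁆ * ξ ⁅x 1, x 3⁆ + ξ ⁅x 0, x 3⁆ * ξ ⁅x 1, x 2⁆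

variable (L) in
/-- Some form `ξ ∘ ⁅·,·⁆` has rank at least four. -/
def HasRankFour : Prop := ∃ (ξ : Module.Dual ℝ L) (x : Fin 4 → L), pfaffian ξ x ≠ 0

theorem HasRankFour.map (e : L ≃ₗ⁅ℝ⁆ L') (h : HasRankFour L) : HasRankFour L' := by
  obtain ⟨ξ, x, hx⟩ := h
  refine ⟨ξ ∘ₗ (e.symm.toLinearEquiv : L' →ₗ[ℝ] L), fun i => e (x i), ?_⟩
  have h1 : ∀ i j, (ξ ∘ₗ (e.symm.toLinearEquiv : L' →ₗ[ℝ] L)) ⁅e (x i), e (x j)⁆ =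
      ξ ⁅x i, x j⁆ := fun i j => by
    rw [← LieEquiv.map_lie]
    exact congrArg ξ (e.symm_apply_apply _)
  simpa only [pfaffian, h1] using hx

/-- The `e`-component of the bracket is the form `a* ∧ d* + b* ∧ c*`, nondegenerate on `⟨a, b, c,
d⟩`. -/
theorem hasRankFour_g53 : HasRankFour (Alg g53) := by
  refine ⟨(LinearMap.proj 4 : V5 →ₗ[ℝ] ℝ), fun i => (Pi.single i.castSucc 1 : V5), ?_⟩
  change (g53.1.1 _ _ : V5) 4 * (g53.1.1 _ _ : V5) 4 - (g53.1.1 _ _ : V5) 4 * (g53.1.1 _ _ : V5) 4 +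
    (g53.1.1 _ _ : V5) 4 * (g53.1.1 _ _ : V5) 4 ≠ 0
  simp [g53, E_apply]

/-- All components of the bracket are divisible by `a*`, so `ξ ∘ ⁅·,·⁆` is decomposable. -/
theorem not_hasRankFour_f4R : ¬ HasRankFour (Alg f4R) := by
  rintro ⟨ξ, x, hx⟩
  let ξ' : V5 →ₗ[ℝ] ℝ := ξ
  let y : Fin 4 → V5 := x
  apply hx
  change ξ' (f4R.1.1 (y 0) (y 1)) * ξ' (f4R.1.1 (y 2) (y 3)) -
    ξ' (f4R.1.1 (y 0) (y 2)) * ξ' (f4R.1.1 (y 1) (y 3)) +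
    ξ' (f4R.1.1 (y 0) (y 3)) * ξ' (f4R.1.1 (y 1) (y 2)) = 0
  simp only [f4R, Submodule.coe_add, LinearMap.add_apply, E_apply, map_add, map_smul, smul_eq_mul]
  ring

/-- Every form `ξ ∘ ⁅·,·⁆` involves only the three coordinates `a*, b*, c*`, so its rank is at most
two. -/
theorem not_hasRankFour_g54 : ¬ HasRankFour (Alg g54) := by
  rintro ⟨ξ, x, hx⟩
  let ξ' : V5 →ₗ[ℝ] ℝ := ξ
  let y : Fin 4 → V5 := x
  apply hx
  change ξ' (g54.1.1 (y 0) (y 1)) * ξ' (g54.1.1 (y 2) (y 3)) -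
    ξ' (g54.1.1 (y 0) (y 2)) * ξ' (g54.1.1 (y 1) (y 3)) +
    ξ' (g54.1.1 (y 0) (y 3)) * ξ' (g54.1.1 (y 1) (y 2)) = 0
  simp only [g54, Submodule.coe_add, LinearMap.add_apply, E_apply, map_add, map_smul, smul_eq_mul]
  ring

theorem table_eq_of_lieEquiv {i j : Fin 8} (e : Alg (table i) ≃ₗ⁅ℝ⁆ Alg (table j)) : i = j := by
  have hb : ∀ i, Module.finrank ℝ (coboundary (Alg (table i))) =
      (![9, 10, 12, 14, 15, 15, 16, 17] : Fin 8 → ℕ) i := by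
    intro i
    fin_cases i
    · exact tableRow_f3R2.2.2.2.1
    · exact tableRow_g51.2.2.2.1
    · exact tableRow_g52.2.2.2.1
    · exact tableRow_f4R.2.2.2.1
    · exact tableRow_g53.2.2.2.1
    · exact tableRow_g54.2.2.2.1
    · exact tableRow_f5.2.2.2.1
    · exact tableRow_g56.2.2.2.1
  have h := finrank_coboundary_eq e
  rw [hb, hb] at h
  have key : ∀ i j : Fin 8, (![9, 10, 12, 14, 15, 15, 16, 17] : Fin 8 → ℕ) i =
      (![9, 10, 12, 14, 15, 15, 16, 17] : Fin 8 → ℕ) j → i = j ∨ i = 4 ∧ j = 5 ∨ i = 5 ∧ j = 4 := by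
    decide
  rcases key i j h with h | ⟨rfl, rfl⟩ | ⟨rfl, rfl⟩
  · exact h
  · exact absurd (hasRankFour_g53.map e) not_hasRankFour_g54
  · exact absurd (hasRankFour_g53.map e.symm) not_hasRankFour_g54

theorem existsUnique_table (L : Type*) [LieRing L] [LieAlgebra ℝ L] (hL : Module.finrank ℝ L = 5)
    (hnil : LieRing.IsNilpotent L) (hne : ¬ IsLieAbelian L) :
    ∃! i : Fin 8, Nonempty (L ≃ₗ⁅ℝ⁆ Alg (table i)) := by
  have hne' : ∃ x y : L, ⁅x, y⁆ ≠ 0 := by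
    by_contra! h
    exact hne ⟨h⟩
  obtain ⟨i, ⟨e⟩⟩ := isInTable_of_finrank_five hL hne'
  exact ⟨i, ⟨e⟩, fun j ⟨e'⟩ => table_eq_of_lieEquiv (e'.symm.trans e)⟩

end Invariants

/-! ### Rigidity of `𝔤₅,₃` -/

section Rigidity

/-- A Lie algebra isomorphism puts brackets into the same orbit. -/
theorem mem_orbit_of_lieEquiv {V : Type*} [AddCommGroup V] [Module ℝ V] {μ ν : lieVariety V}
    (e : Alg μ ≃ₗ⁅ℝ⁆ Alg ν) : μ.1 ∈ orbit ν.1 := by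
  let g : V ≃ₗ[ℝ] V := e.symm.toLinearEquiv
  refine ⟨g, Subtype.ext (LinearMap.ext₂ fun x y => ?_)⟩
  change g (ν.1.1 (g.symm x) (g.symm y)) = μ.1.1 x y
  refine g.eq_symm_apply.1 ?_
  exact (e.map_lie (show Alg μ from x) (show Alg μ from y)).symm

theorem iterN_act {V : Type*} [AddCommGroup V] [Module ℝ V] (g : V ≃ₗ[ℝ] V) (μ : AltBracket V)
    (k : ℕ) (x : Fin (k + 1) → V) :
    iterN (act g μ).1 k (fun i => g (x i)) = g (iterN μ.1 k x) := by
  induction k with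
  | zero => rfl
  | succ k ih =>
    have h := ih (Fin.init x)
    change g (μ.1 (g.symm (iterN (act g μ).1 k fun i => g (Fin.init x i))) (g.symm (g _))) = _
    rw [h, g.symm_apply_apply, g.symm_apply_apply]
    rfl

theorem act_mem_nilVariety {V : Type*} [AddCommGroup V] [Module ℝ V] (g : V ≃ₗ[ℝ] V)
    {μ : AltBracket V} {k : ℕ} (hμ : μ ∈ nilVariety V k) : act g μ ∈ nilVariety V k := by
  refine ⟨fun x y z => ?_, fun x => ?_⟩
  · have h := congrArg g (hμ.1 (g.symm x) (g.symm y) (g.symm z))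
    simpa [act] using h
  · have h := iterN_act g μ k fun i => g.symm (x i)
    simpa [hμ.2] using h

/-! ### Polynomial conditions that single out the orbit. -/

variable {V : Type*} [AddCommGroup V] [Module ℝ V]

/-- The linear form `σ ↦ ξ(σ(x, y))`. -/
def bracketForm (ξ : Module.Dual ℝ V) (x y : V) : Module.Dual ℝ (AltBracket V) where
  toFun σ := ξ (σ.1 x y)
  map_add' _ _ := by simp
  map_smul' _ _ := by simp

/-- The Pfaffian of `ξ ∘ σ` as a polynomial in `σ`. -/
noncomputable def pfaffianPoly (ξ : Module.Dual ℝ V) (x : Fin 4 → V) :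
    MvPolynomial (Module.Dual ℝ (AltBracket V)) ℝ :=
  .X (bracketForm ξ (x 0) (x 1)) * .X (bracketForm ξ (x 2) (x 3)) -
    .X (bracketForm ξ (x 0) (x 2)) * .X (bracketForm ξ (x 1) (x 3)) +
    .X (bracketForm ξ (x 0) (x 3)) * .X (bracketForm ξ (x 1) (x 2))

/-- `ξ(σ(σ(x, y), z))` as a polynomial in `σ`. -/
noncomputable def doubleBracketPoly (ξ : Module.Dual ℝ V5) (x y z : V5) :
    MvPolynomial (Module.Dual ℝ (AltBracket V5)) ℝ :=
  ∑ m, .X (bracketForm (LinearMap.proj m) x y) * .X (bracketForm ξ (Pi.single m 1) z)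

theorem eval_doubleBracketPoly (ξ : Module.Dual ℝ V5) (x y z : V5) (σ : AltBracket V5) :
    MvPolynomial.eval (fun φ : Module.Dual ℝ (AltBracket V5) => φ σ)
      (doubleBracketPoly ξ x y z) = ξ (σ.1 (σ.1 x y) z) := by
  have h := LinearMap.pi_apply_eq_sum_univ (ξ ∘ₗ σ.1.flip z) (σ.1 x y)
  change ξ (σ.1 (σ.1 x y) z) = _ at h
  rw [h]
  simp only [doubleBracketPoly, map_sum, map_mul, MvPolynomial.eval_X]
  refine Finset.sum_congr rfl fun m _ => ?_
  have hm : (Pi.single m 1 : V5) = fun j => if m = j then 1 else 0 := by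
    ext j
    simp [Pi.single_apply, eq_comm]
  rw [← hm]
  rfl

theorem eq_four_of_hasRankFour {i : Fin 8} (h : (table i).1 ∉ nilVariety V5 2)
    (h' : (table i).1 ∈ nilVariety V5 3) (hr : HasRankFour (Alg (table i))) : i = 4 := by
  fin_cases i
  · exact absurd tableRow_f3R2.1 h
  · exact absurd tableRow_g51.1 h
  · exact absurd tableRow_g52.1 h
  · exact absurd hr not_hasRankFour_f4R
  · rfl
  · exact absurd hr not_hasRankFour_g54
  · exact absurd h' (tableRow_f5.2.1 3 (by decide))
  · exact absurd h' (tableRow_g56.2.1 3 (by decide))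

/-- The open set is where a product of a Pfaffian and a double bracket is nonzero. The second factor
is needed to exclude the 2-step algebras: `g51` has a form of rank four as well. -/
theorem isRigidIn_g53 : IsRigidIn (nilVariety V5 3) g53.1 := by
  refine ⟨tableRow_g53.1, {p | ∃ ξ x η y₁ y₂ y₃,
    p = pfaffianPoly ξ x * doubleBracketPoly η y₁ y₂ y₃}, ?_⟩
  ext μ
  constructor
  · rintro ⟨g, rfl⟩
    -- Witnesses for `g53` itself, transported by `g`: the `e`-coordinate on `a, b, c, d` for the
    -- Pfaffian, and `⁅⁅a, b⁆, a⁆ = -e` for the double bracket.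
    refine ⟨act_mem_nilVariety g tableRow_g53.1, _, ⟨LinearMap.proj 4 ∘ₗ (g.symm : V5 →ₗ[ℝ] V5),
      fun i => g (Pi.single i.castSucc 1), LinearMap.proj 4 ∘ₗ (g.symm : V5 →ₗ[ℝ] V5),
      g (Pi.single 0 1), g (Pi.single 1 1), g (Pi.single 0 1), rfl⟩, ?_⟩
    rw [map_mul, eval_doubleBracketPoly]
    simp [pfaffianPoly, bracketForm, act, g53, E_apply]
  · rintro ⟨hμ, p, ⟨ξ, x, η, y₁, y₂, y₃, rfl⟩, hp⟩
    rw [map_mul, eval_doubleBracketPoly] at hp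
    obtain ⟨hp1, hp2⟩ := mul_ne_zero_iff.1 hp
    let μ' : lieVariety V5 := ⟨μ, hμ.1⟩
    have hrank : HasRankFour (Alg μ') := by
      refine ⟨ξ, x, ?_⟩
      intro h
      apply hp1
      simp only [pfaffianPoly, map_add, map_sub, map_mul, MvPolynomial.eval_X]
      exact h
    have hdouble : μ.1 (μ.1 y₁ y₂) y₃ ≠ 0 := fun h => hp2 (by rw [h, map_zero])
    have hnil : LieRing.IsNilpotent (Alg μ') :=
      LieModule.IsNilpotent.mk (Alg μ') ((mem_nilVariety_iff μ' 3).1 hμ)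
    have hne : ∃ x y : Alg μ', ⁅x, y⁆ ≠ 0 := ⟨μ.1 y₁ y₂, y₃, hdouble⟩
    have hdim : Module.finrank ℝ (Alg μ') = 5 := Module.finrank_fin_fun ℝ
    obtain ⟨i, ⟨e⟩⟩ := isInTable_of_finrank_five hdim hne
    have h1 : μ'.1 ∈ orbit (table i).1 := mem_orbit_of_lieEquiv e
    have h2 : (table i).1 ∈ orbit μ'.1 := mem_orbit_of_lieEquiv e.symm
    -- Being at most 2-step is constant on orbits, and `μ` has a nonzero double bracket.
    have hnot : (table i).1 ∉ nilVariety V5 2 := fun h => by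
      obtain ⟨g, hg : act g (table i).1 = μ'.1⟩ := h1
      have h3 := act_mem_nilVariety g h
      rw [hg] at h3
      exact hdouble (h3.2 ![y₁, y₂, y₃])
    have hmem : (table i).1 ∈ nilVariety V5 3 := by
      obtain ⟨g, hg : act g μ'.1 = (table i).1⟩ := h2
      rw [← hg]
      exact act_mem_nilVariety g hμ
    have hi := eq_four_of_hasRankFour hnot hmem (hrank.map e)
    rw [hi] at h1
    exact h1

end Rigidity

end NilLie

theorem mainTheorem9 :
    -- `𝔤₅,₃` is rigid in the variety of at most 3-step nilpotent brackets on `ℝ⁵`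
    NilLie.IsRigidIn (NilLie.nilVariety NilLie.V5 3) NilLie.g53.1 ∧
    -- `H²_{3-nil}(𝔤₅,₃, 𝔤₅,₃)` is 2-dimensional, spanned by the classes of `ν₁` and `ν₂`
    Module.finrank ℝ (NilLie.H2nil (NilLie.Alg NilLie.g53) 3) = 2 ∧
    (∃ (h₁ : NilLie.toCochain NilLie.g53 NilLie.nu1 ∈
          NilLie.nilCocycle (NilLie.Alg NilLie.g53) 3)
       (h₂ : NilLie.toCochain NilLie.g53 NilLie.nu2 ∈
          NilLie.nilCocycle (NilLie.Alg NilLie.g53) 3),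
      Submodule.span ℝ {NilLie.H2nil.mk (NilLie.Alg NilLie.g53) 3 ⟨_, h₁⟩,
        NilLie.H2nil.mk (NilLie.Alg NilLie.g53) 3 ⟨_, h₂⟩} = ⊤) ∧
    -- `μ + tν₁` and `μ + tν₂` are solvable deformations of `𝔤₅,₃`
    NilLie.IsSolvableLinearDeformation NilLie.g53 NilLie.nu1 ∧
    NilLie.IsSolvableLinearDeformation NilLie.g53 NilLie.nu2 ∧
    -- rigidity does not imply vanishing of the cohomology
    (¬ ∀ μ : NilLie.lieVariety NilLie.V5,
      NilLie.IsRigidIn (NilLie.nilVariety NilLie.V5 3) μ.1 →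
        Subsingleton (NilLie.H2nil (NilLie.Alg μ) 3)) ∧
    -- the table of the eight algebras
    NilLie.TableRow NilLie.f3R2 2 11 20 9 ∧
    NilLie.TableRow NilLie.g51 2 0 10 10 ∧
    NilLie.TableRow NilLie.g52 2 0 12 12 ∧
    NilLie.TableRow NilLie.f4R 3 4 18 14 ∧
    NilLie.TableRow NilLie.g53 3 2 17 15 ∧
    NilLie.TableRow NilLie.g54 3 0 15 15 ∧
    NilLie.TableRow NilLie.f5 4 1 17 16 ∧
    NilLie.TableRow NilLie.g56 4 0 17 17 ∧
    -- the table is complete and without repetition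
    (∀ (L : Type*) [LieRing L] [LieAlgebra ℝ L], Module.finrank ℝ L = 5 →
      LieRing.IsNilpotent L → ¬ IsLieAbelian L →
        ∃! i : Fin 8, Nonempty (L ≃ₗ⁅ℝ⁆ NilLie.Alg (NilLie.table i))) := by
  have hne : ¬ ∀ μ : NilLie.lieVariety NilLie.V5,
      NilLie.IsRigidIn (NilLie.nilVariety NilLie.V5 3) μ.1 →
        Subsingleton (NilLie.H2nil (NilLie.Alg μ) 3) := fun h => by
    have := h NilLie.g53 NilLie.isRigidIn_g53
    have h2 := NilLie.tableRow_g53.2.2.2.2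
    rw [Module.finrank_zero_of_subsingleton] at h2
    exact absurd h2 (by decide)
  exact ⟨NilLie.isRigidIn_g53, NilLie.tableRow_g53.2.2.2.2,
    ⟨NilLie.nu1_mem, NilLie.nu2_mem, NilLie.span_classes⟩,
    NilLie.isSolvableLinearDeformation_nu1, NilLie.isSolvableLinearDeformation_nu2, hne,
    NilLie.tableRow_f3R2, NilLie.tableRow_g51, NilLie.tableRow_g52, NilLie.tableRow_f4R,
    NilLie.tableRow_g53, NilLie.tableRow_g54, NilLie.tableRow_f5, NilLie.tableRow_g56,
    fun L _ _ hL hnil hne => NilLie.existsUnique_table L hL hnil hne⟩
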